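/- Let $(M_i,g_i)$, $i=1,2,3$, be connected smooth semi-Riemannian manifolds of dimensions $m_i\ge 1$ (any signature), and let $f\colon M_1\to(0,\infty)$ and $h\colon M_1\times M_2\to(0,\infty)$ be smooth. Let $\bar M=(M_1\times_f M_2)\times_h M_3$ be the sequential warped product, i.e. $(M_1\times M_2)\times M_3$ with the metric $\bar g=(g_1\oplus f^2g_2)\oplus h^2g_3$; put $n=m_1+m_2+m_3$ and let $\bar\tau$ be its scalar curvature. Let $\alpha,\beta\in\mathbb R\setminus\{0\}$ and suppose that $(\bar M,\bar g)$ is pseudo-projectively flat, i.e. the tensor $$P(X,Y)Z=\alpha R(X,Y)Z+\beta[\mathrm{Ric}(Y,Z)X-\mathrm{Ric}(X,Z)Y]-\tfrac{\tau}{n}\bigl(\tfrac{\alpha}{n-1}+\beta\bigr)[g(Y,Z)X-g(X,Z)Y]$$ of $(\bar M,\bar g)$ vanishes identically, where $R(X,Y)Z=[\nabla_X,\nabla_Y]Z-\nabla_{[X,Y]}Z$ and $\mathrm{Ric}(X,Y)=\mathrm{tr}(V\mapsto R(V,X)Y)$. Write $H_i^\varphi$, $\Delta_i$, $\nabla_i$,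 $\mathrm{Ric}_i$, $\tau_i$ for the Hessian, Laplacian, gradient, Ricci tensor and scalar curvature of $(M_i,g_i)$, where $h$ is regarded as a function on $M_1$ (resp. $M_2$) by fixing the other argument, and set $f^\sharp=f\Delta_1f+(m_2-1)\|\nabla_1f\|^2$, $$\lambda_1=\tfrac{\bar\tau}{n}\bigl(\tfrac{\alpha}{n-1}+\beta\bigr)m_1-\beta\tau_1+\beta\tfrac{m_2}{f}\Delta_1f+\beta\tfrac{m_3}{h}\Delta_1h,$$ $$\lambda_2=-\beta\tau_2+\beta(m_2-1)f^\sharp+\tfrac{\beta m_3}{h}\bigl(m_2f\,g_1(\nabla_1h,\nabla_1f)+\Delta_2h\bigr)-\beta m_3\tfrac fh\,g_1(\nabla_1h,\nabla_1f)+(m_2-1)\Bigl[\alpha\|\nabla_1f\|^2+\tfrac{\bar\tau}{n}\bigl(\tfrac{\alpha}{n-1}+\beta\bigr)f^2\Bigr].$$ A semi-Riemannian manifold $(M,g)$ with smooth functions $\varphi,a,\lambda$ is called generalized quasi-Einstein (in the sense of Catino) if $\mathrm{Ric}+H^\varphi-a\,d\varphi\otimes d\varphi=\lambda g$; it is a conformal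 gradient soliton with potential $\varphi$ if $\varphi$ is smooth and non-constant and $H^\varphi=\psi g$ for a smooth function $\psi$; it is Einstein if $\mathrm{Ric}=cg$ for a constant $c$. Then: 1. For all fixed $y\in M_2$, $z\in M_3$, $(M_1,g_1)$ is generalized quasi-Einstein with $\varphi=-\ln f$, $a=1$ and $\lambda=\lambda_1/\alpha$. 2. Suppose $\alpha\ne\beta$ and fix $x\in M_1$, $z\in M_3$. With the constant $\mu=\beta m_3/(\alpha-\beta)$, $(M_2,g_2)$ is generalized quasi-Einstein with $\varphi=\mu\ln h(x,\cdot)$, $a=-1/\mu$ and $\lambda=\lambda_2/(\alpha-\beta)$. Moreover, for $\mu=\beta m_3f(x)^2/(\alpha-\beta)$ it is also generalized quasi-Einstein with $\varphi=\mu\ln h(x,\cdot)$, $a=-1/\mu$ and some smooth $\lambda$. If $\alpha=\beta$, then for all $x\in M_1$, $z\in M_3$ the conformal gradient soliton equation $H_2^{h}=\frac{h\lambda_2}{\beta m_3}\,g_2$ holds on $M_2$ for $h=h(x,\cdot)$, with smooth factor; in particular $(M_2,g_2)$ is a conformal gradient soliton with potential $h(x,\cdot)$ whenever $h(x,\cdot)$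 is not constant. 3. If $\alpha\ne\beta$, then $(M_3,g_3)$ is Einstein. 4. $\frac1f H_1^f=\frac1h H_1^h$ on $M_1$, for every fixed point of $M_2$. -/

import Mathlib

open scoped Manifold ContDiff

set_option maxSynthPendingDepth 3

noncomputable section

namespace SeqWarped

/-! ### Semi-Riemannian calculus on a finite-dimensional vector space

Here `G : E → E →L[ℝ] E →L[ℝ] ℝ` is the coordinate expression of a metric, and vectors
`X Y Z : E` stand for the coordinate vector fields with these constant components. -/

section Local

variable {E : Type*} [NormedAddCommGroup E] [NormedSpace ℝ E]

/-- Christoffel symbols of the first kind, as a form in the last argument: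
`Z ↦ (∂_X G(Y,Z) + ∂_Y G(X,Z) - ∂_Z G(X,Y)) / 2`. -/
def christoffelLower (G : E → E →L[ℝ] E →L[ℝ] ℝ) (u : E) : E →L[ℝ] E →L[ℝ] E →L[ℝ] ℝ :=
  let D : E →L[ℝ] E →L[ℝ] E →L[ℝ] ℝ := fderiv ℝ G u
  let flipCLM : (E →L[ℝ] E →L[ℝ] ℝ) →L[ℝ] (E →L[ℝ] E →L[ℝ] ℝ) :=
    (ContinuousLinearMap.flipₗᵢ ℝ E E ℝ).toContinuousLinearEquiv.toContinuousLinearMap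
  (1 / 2 : ℝ) • (D + D.flip - flipCLM.comp D.flip)

theorem christoffelLower_apply (G : E → E →L[ℝ] E →L[ℝ] ℝ) (u X Y Z : E) :
    christoffelLower G u X Y Z =
      (fderiv ℝ G u X Y Z + fderiv ℝ G u Y X Z - fderiv ℝ G u Z X Y) / 2 := by
  simp [christoffelLower]
  ring

/-- Christoffel symbols `Γ(X,Y) = ∇_X Y` of the Levi-Civita connection:
`G(Γ(X,Y), Z) = christoffelLower G u X Y Z` (for nondegenerate `G u`). -/
def christoffel (G : E → E →L[ℝ] E →L[ℝ] ℝ) (u : E) : E →L[ℝ] E →L[ℝ] E :=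
  (ContinuousLinearMap.compL ℝ E (E →L[ℝ] ℝ) E (G u).inverse).comp (christoffelLower G u)

/-- `R(X,Y)Z = ∇_X ∇_Y Z - ∇_Y ∇_X Z` for coordinate (hence commuting) fields. -/
def curvatureLocal (G : E → E →L[ℝ] E →L[ℝ] ℝ) (u X Y Z : E) : E :=
  fderiv ℝ (christoffel G) u X Y Z - fderiv ℝ (christoffel G) u Y X Z
    + christoffel G u X (christoffel G u Y Z) - christoffel G u Y (christoffel G u X Z)

/-- `V ↦ R(V,X)Y`. -/
def curvatureEndo (G : E → E →L[ℝ] E →L[ℝ] ℝ) (u X Y : E) : E →ₗ[ℝ] E where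
  toFun V := curvatureLocal G u V X Y
  map_add' V W := by simp only [curvatureLocal, map_add, add_apply]; abel
  map_smul' c V := by
    simp only [curvatureLocal, map_smul, smul_apply, RingHom.id_apply, smul_add, smul_sub]

/-- `Ric(X,Y) = tr (V ↦ R(V,X)Y)`, that is `∑ εᵢ G(R(eᵢ,X)Y, eᵢ)` in an orthonormal basis. -/
def ricciLocal (G : E → E →L[ℝ] E →L[ℝ] ℝ) (u : E) : LinearMap.BilinForm ℝ E :=
  LinearMap.mk₂ ℝ (fun X Y => LinearMap.trace ℝ E (curvatureEndo G u X Y))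
    (fun X X' Y => by
      rw [← map_add]; congr 1; ext V
      simp only [curvatureEndo, curvatureLocal, map_add, LinearMap.coe_mk, AddHom.coe_mk,
        LinearMap.add_apply, add_apply]
      abel)
    (fun c X Y => by
      rw [← map_smul]; congr 1; ext V
      simp only [curvatureEndo, curvatureLocal, map_smul, LinearMap.coe_mk, AddHom.coe_mk,
        LinearMap.smul_apply, smul_apply, smul_add, smul_sub])
    (fun X Y Y' => by
      rw [← map_add]; congr 1; ext V
      simp only [curvatureEndo, curvatureLocal, map_add, LinearMap.coe_mk, AddHom.coe_mk,
        LinearMap.add_apply]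
      abel)
    (fun c X Y => by
      rw [← map_smul]; congr 1; ext V
      simp only [curvatureEndo, curvatureLocal, map_smul, LinearMap.coe_mk, AddHom.coe_mk,
        LinearMap.smul_apply, smul_add, smul_sub])

/-- Metric trace of a bilinear form: `∑ εᵢ B(eᵢ,eᵢ)` in an orthonormal basis. -/
def metricTrace [FiniteDimensional ℝ E] (g : E →L[ℝ] E →L[ℝ] ℝ)
    (B : LinearMap.BilinForm ℝ E) : ℝ :=
  LinearMap.trace ℝ E ((g.inverse : (E →L[ℝ] ℝ) →ₗ[ℝ] E) ∘ₗ
    (LinearMap.toContinuousLinearMap : (E →ₗ[ℝ] ℝ) ≃ₗ[ℝ] (E →L[ℝ] ℝ)).toLinearMap ∘ₗ B)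

/-- `H^φ(X,Y) = X(Y φ) - (∇_X Y) φ`. -/
def hessianLocal (G : E → E →L[ℝ] E →L[ℝ] ℝ) (φ : E → ℝ) (u : E) : LinearMap.BilinForm ℝ E :=
  LinearMap.mk₂ ℝ (fun X Y => fderiv ℝ (fderiv ℝ φ) u X Y - fderiv ℝ φ u (christoffel G u X Y))
    (fun X X' Y => by simp only [map_add, add_apply]; ring)
    (fun c X Y => by simp only [map_smul, smul_apply, smul_sub])
    (fun X Y Y' => by simp only [map_add]; ring)
    (fun c X Y => by simp only [map_smul, smul_sub])

end Local

/-! ### Semi-Riemannian manifolds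

All tensors at `p` are computed in the preferred chart at `p`; the tangent space `T_p M` is `E`,
identified through that same chart. -/

section Manifold

variable {E : Type*} [NormedAddCommGroup E] [NormedSpace ℝ E]
  {H : Type*} [TopologicalSpace H] (I : ModelWithCorners ℝ E H)
  {M : Type*} [TopologicalSpace M] [ChartedSpace H M]

/-- A smooth field of symmetric nondegenerate bilinear forms (of any signature). -/
structure IsSemiRiemannian [IsManifold I ∞ M]
    (g : ∀ p : M, TangentSpace I p →L[ℝ] TangentSpace I p →L[ℝ] ℝ) : Prop where
  symm : ∀ (p : M) (X Y : TangentSpace I p), g p X Y = g p Y X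
  nondegenerate : ∀ (p : M) (X : TangentSpace I p), (∀ Y, g p X Y = 0) → X = 0
  smooth : ContMDiff I (I.prod 𝓘(ℝ, E →L[ℝ] E →L[ℝ] ℝ)) ∞
    (fun p => Bundle.TotalSpace.mk' (E →L[ℝ] E →L[ℝ] ℝ)
      (E := fun p : M => TangentSpace I p →L[ℝ] TangentSpace I p →L[ℝ] ℝ) p (g p))

/-- The form `g_p`, read on the model space `E = T_p M`. -/
def formAt (g : ∀ p : M, TangentSpace I p →L[ℝ] TangentSpace I p →L[ℝ] ℝ) (p : M) :
    E →L[ℝ] E →L[ℝ] ℝ :=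
  g p

/-- Derivative at `u` of the inverse of the preferred chart at `p`. -/
def chartSymmDeriv (p : M) (u : E) : E →L[ℝ] E :=
  mfderiv 𝓘(ℝ, E) I (extChartAt I p).symm u

/-- The coordinate expression of `g` in the preferred chart at `p`. -/
def localMetric (g : ∀ p : M, TangentSpace I p →L[ℝ] TangentSpace I p →L[ℝ] ℝ) (p : M) :
    E → E →L[ℝ] E →L[ℝ] ℝ :=
  fun u => (formAt I g ((extChartAt I p).symm u)).bilinearComp 
    (chartSymmDeriv I p u) (chartSymmDeriv I p u)

variable (g : ∀ p : M, TangentSpace I p →L[ℝ] TangentSpace I p →L[ℝ] ℝ)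

/-- The Riemann curvature `R(X,Y)Z` at `p`. -/
def curvature (p : M) (X Y Z : TangentSpace I p) : TangentSpace I p :=
  curvatureLocal (E := E) (localMetric I g p) (extChartAt I p p) X Y Z

/-- The Ricci tensor at `p`. -/
def ricci (p : M) (X Y : TangentSpace I p) : ℝ :=
  ricciLocal (localMetric I g p) (extChartAt I p p) X Y

/-- The scalar curvature `τ`. -/
def scalarCurvature [FiniteDimensional ℝ E] (p : M) : ℝ :=
  metricTrace (localMetric I g p (extChartAt I p p))
    (ricciLocal (localMetric I g p) (extChartAt I p p))

/-- The Hessian `H^φ` at `p`. -/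
def hessian (φ : M → ℝ) (p : M) (X Y : TangentSpace I p) : ℝ :=
  hessianLocal (localMetric I g p) (φ ∘ (extChartAt I p).symm) (extChartAt I p p) X Y

/-- The Laplacian `Δφ = tr_g H^φ`. -/
def laplacian [FiniteDimensional ℝ E] (φ : M → ℝ) (p : M) : ℝ :=
  metricTrace (localMetric I g p (extChartAt I p p))
    (hessianLocal (localMetric I g p) (φ ∘ (extChartAt I p).symm) (extChartAt I p p))

/-- The differential `dφ` at `p`. -/
def differential (φ : M → ℝ) (p : M) : TangentSpace I p →L[ℝ] ℝ :=
  mfderiv I 𝓘(ℝ, ℝ) φ p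

/-- The gradient: `g(grad φ, X) = dφ(X)`. -/
def gradient (φ : M → ℝ) (p : M) : TangentSpace I p :=
  (formAt I g p).inverse (differential I φ p)

/-- `g(grad φ, grad ψ)`. -/
def gradInner (φ ψ : M → ℝ) (p : M) : ℝ :=
  g p (gradient I g φ p) (gradient I g ψ p)

/-- The pseudo-projective curvature tensor `P(X,Y)Z` with parameters `α, β`. -/
def pseudoProjective [FiniteDimensional ℝ E] (α β : ℝ) (p : M) (X Y Z : TangentSpace I p) :
    TangentSpace I p :=
  α • curvature I g p X Y Z + β • (ricci I g p Y Z • X - ricci I g p X Z • Y)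
    - (scalarCurvature I g p / (Module.finrank ℝ E : ℝ)
        * (α / ((Module.finrank ℝ E : ℝ) - 1) + β)) • (g p Y Z • X - g p X Z • Y)

/-- `P = 0` identically. -/
def IsPseudoProjectivelyFlat [FiniteDimensional ℝ E] (α β : ℝ) : Prop :=
  ∀ (p : M) (X Y Z : TangentSpace I p), pseudoProjective I g α β p X Y Z = 0

/-- Catino's equation `Ric + H^φ - a dφ ⊗ dφ = l g` with smooth `φ, a, l`. -/
structure IsGeneralizedQuasiEinstein (φ a l : M → ℝ) : Prop where
  smooth_potential : ContMDiff I 𝓘(ℝ, ℝ) ∞ φ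
  smooth_coeff : ContMDiff I 𝓘(ℝ, ℝ) ∞ a
  smooth_factor : ContMDiff I 𝓘(ℝ, ℝ) ∞ l
  equation : ∀ (p : M) (X Y : TangentSpace I p),
    ricci I g p X Y + hessian I g φ p X Y - a p * (differential I φ p X * differential I φ p Y)
      = l p * g p X Y

/-- The conformal gradient soliton equation `H^φ = l g` with smooth `φ, l`. -/
structure SatisfiesConformalGradientEq (φ l : M → ℝ) : Prop where
  smooth_potential : ContMDiff I 𝓘(ℝ, ℝ) ∞ φ
  smooth_factor : ContMDiff I 𝓘(ℝ, ℝ) ∞ l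
  equation : ∀ (p : M) (X Y : TangentSpace I p), hessian I g φ p X Y = l p * g p X Y

/-- `φ` is a (non-constant) potential making `(M,g)` a conformal gradient soliton. -/
def IsConformalGradientSoliton (φ : M → ℝ) : Prop :=
  (¬ ∃ c : ℝ, ∀ p, φ p = c) ∧ ∃ l : M → ℝ, SatisfiesConformalGradientEq I g φ l

/-- `Ric = c g` with a constant `c`. -/
def IsEinstein : Prop :=
  ∃ c : ℝ, ∀ (p : M) (X Y : TangentSpace I p), ricci I g p X Y = c * g p X Y

end Manifold

section Warped

variable {E : Type*} [NormedAddCommGroup E] [NormedSpace ℝ E]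
  {H : Type*} [TopologicalSpace H] (I : ModelWithCorners ℝ E H)
  {B : Type*} [TopologicalSpace B] [ChartedSpace H B]
  {E' : Type*} [NormedAddCommGroup E'] [NormedSpace ℝ E']
  {H' : Type*} [TopologicalSpace H'] (I' : ModelWithCorners ℝ E' H')
  {F : Type*} [TopologicalSpace F] [ChartedSpace H' F]

/-- The warped product metric `g_B ⊕ f² g_F` on `B × F`; the tangent space of the product at `p`
is the product `E × E'` of the tangent spaces. -/
def warpedMetric (gB : ∀ p : B, TangentSpace I p →L[ℝ] TangentSpace I p →L[ℝ] ℝ)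
    (gF : ∀ p : F, TangentSpace I' p →L[ℝ] TangentSpace I' p →L[ℝ] ℝ) (f : B → ℝ) (p : B × F) :
    TangentSpace (I.prod I') p →L[ℝ] TangentSpace (I.prod I') p →L[ℝ] ℝ :=
  ((formAt I gB p.1).bilinearComp (ContinuousLinearMap.fst ℝ E E') (ContinuousLinearMap.fst ℝ E E')
    + (f p.1) ^ 2 • (formAt I' gF p.2).bilinearComp (ContinuousLinearMap.snd ℝ E E')
        (ContinuousLinearMap.snd ℝ E E') : E × E' →L[ℝ] E × E' →L[ℝ] ℝ)

end Warped

section Sequential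

variable {E₁ : Type*} [NormedAddCommGroup E₁] [NormedSpace ℝ E₁]
  {H₁ : Type*} [TopologicalSpace H₁] (I₁ : ModelWithCorners ℝ E₁ H₁)
  {M₁ : Type*} [TopologicalSpace M₁] [ChartedSpace H₁ M₁]
  {E₂ : Type*} [NormedAddCommGroup E₂] [NormedSpace ℝ E₂]
  {H₂ : Type*} [TopologicalSpace H₂] (I₂ : ModelWithCorners ℝ E₂ H₂)
  {M₂ : Type*} [TopologicalSpace M₂] [ChartedSpace H₂ M₂]
  {E₃ : Type*} [NormedAddCommGroup E₃] [NormedSpace ℝ E₃]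
  {H₃ : Type*} [TopologicalSpace H₃] (I₃ : ModelWithCorners ℝ E₃ H₃)
  {M₃ : Type*} [TopologicalSpace M₃] [ChartedSpace H₃ M₃]
  (g₁ : ∀ p : M₁, TangentSpace I₁ p →L[ℝ] TangentSpace I₁ p →L[ℝ] ℝ)
  (g₂ : ∀ p : M₂, TangentSpace I₂ p →L[ℝ] TangentSpace I₂ p →L[ℝ] ℝ)
  (g₃ : ∀ p : M₃, TangentSpace I₃ p →L[ℝ] TangentSpace I₃ p →L[ℝ] ℝ)
  (f : M₁ → ℝ) (h : M₁ × M₂ → ℝ)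

/-- The sequential warped product metric `(g₁ ⊕ f² g₂) ⊕ h² g₃` on `(M₁ × M₂) × M₃`. -/
def sequentialMetric (p : (M₁ × M₂) × M₃) :
    TangentSpace ((I₁.prod I₂).prod I₃) p →L[ℝ] TangentSpace ((I₁.prod I₂).prod I₃) p →L[ℝ] ℝ :=
  warpedMetric (I₁.prod I₂) I₃ (warpedMetric I₁ I₂ g₁ g₂ f) g₃ h p

variable [FiniteDimensional ℝ E₁] [FiniteDimensional ℝ E₂] [FiniteDimensional ℝ E₃] (α β : ℝ)

/-- `(τ̄ / n) (α / (n - 1) + β)` with `n = m₁ + m₂ + m₃` and `τ̄` the scalar curvature of the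
sequential warped product. -/
def scalarFactor (p : (M₁ × M₂) × M₃) : ℝ :=
  let n : ℝ := Module.finrank ℝ E₁ + Module.finrank ℝ E₂ + Module.finrank ℝ E₃
  scalarCurvature ((I₁.prod I₂).prod I₃) (sequentialMetric I₁ I₂ I₃ g₁ g₂ g₃ f h) p / n
    * (α / (n - 1) + β)

/-- `λ₁ = (τ̄/n)(α/(n-1)+β) m₁ - β τ₁ + β (m₂/f) Δ₁f + β (m₃/h) Δ₁h`. -/
def lambda₁ (x : M₁) (y : M₂) (z : M₃) : ℝ :=
  scalarFactor I₁ I₂ I₃ g₁ g₂ g₃ f h α β ((x, y), z) * Module.finrank ℝ E₁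
    - β * scalarCurvature I₁ g₁ x
    + β * (Module.finrank ℝ E₂ / f x) * laplacian I₁ g₁ f x
    + β * (Module.finrank ℝ E₃ / h (x, y)) * laplacian I₁ g₁ (fun x' => h (x', y)) x

/-- `f♯ = f Δ₁f + (m₂ - 1) ‖grad₁ f‖²`. -/
def fSharp (E₂ : Type*) [NormedAddCommGroup E₂] [NormedSpace ℝ E₂] (x : M₁) : ℝ :=
  f x * laplacian I₁ g₁ f x + ((Module.finrank ℝ E₂ : ℝ) - 1) * gradInner I₁ g₁ f f x

/-- `λ₂ = β (m₂-1) f♯ - β τ₂ + β (m₃/h) (m₂ f g₁(grad₁ h, grad₁ f) + Δ₂h)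
- β m₃ (f/h) g₁(grad₁ h, grad₁ f) + (m₂-1) (α ‖grad₁ f‖² + (τ̄/n)(α/(n-1)+β) f²)`. -/
def lambda₂ (x : M₁) (y : M₂) (z : M₃) : ℝ :=
  let m₂ : ℝ := Module.finrank ℝ E₂
  let m₃ : ℝ := Module.finrank ℝ E₃
  let hf : ℝ := gradInner I₁ g₁ (fun x' => h (x', y)) f x
  β * (m₂ - 1) * fSharp I₁ g₁ f E₂ x - β * scalarCurvature I₂ g₂ y
    + β * m₃ / h (x, y) * (m₂ * f x * hf + laplacian I₂ g₂ (fun y' => h (x, y')) y)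
    - β * m₃ * (f x / h (x, y)) * hf
    + (m₂ - 1) * (α * gradInner I₁ g₁ f f x
        + scalarFactor I₁ I₂ I₃ g₁ g₂ g₃ f h α β ((x, y), z) * f x ^ 2)

end Sequential

end SeqWarped

end

open SeqWarped

/-! Since `α ≠ 0`, the equation `P = 0` can be solved for the curvature: `R(A,B)C = θ(B,C)A -
θ(A,C)B`, where `θ` combines the metric and the Ricci tensor linearly. On a warped product `B ×_f F`
this algebraic form is rigid. For `X`, `Y` tangent to the base and `V`, `W` to the fibre, `R(X,V)Y =
(H^f(X,Y)/f) V` and `R(X,V)W = -f g_F(V,W) ∇_X grad f`. Comparison with `θ` kills its mixed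
components and separates variables in `θ(V,W) g_B(X,Y) = -f g_F(V,W) H^f(X,Y)`. Hence `θ = κ g` at
each point, `H^f = -κ f g_B`, and base and fibre have curvature of constant-curvature form. This is
`exists_of_curvatureLocal_warpedLocal`.

Applied to `(M₁ × M₂) ×_h M₃`, and then to its base `M₁ ×_f M₂`, the argument makes the Ricci tensor
of every factor, the Hessian of `f`, and the partial Hessians of `h` multiples of the corresponding
metrics (`exists_of_curvatureLocal_sequential`, `SpaceFormEquations`). The trace of `H₁^f = -κ f g₁`
shows that `κ` depends on the point of `M₁` only.

The conclusions are then algebra. If `Ric = r g` and `H^φ = l g`, the potential `c ln φ` with `a =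
-1/c` satisfies Catino's equation with factor `r + c l/φ`
(`isGeneralizedQuasiEinstein_const_mul_log`), and `λ₁`, `λ₂` evaluate to the factors required.
Smoothness of the factors comes from `IsSemiRiemannian.contMDiff_of_hessian_eq`. It rests on the
chart independence of the Hessian, because each tensor is defined in the preferred chart of its own
base point. -/

set_option linter.unusedSectionVars false

open Filter Topology

namespace SeqWarped

/-! ### Metrics, connection, gradient and Hessian in coordinates -/

section LocalMetric

variable {E : Type*} [NormedAddCommGroup E] [NormedSpace ℝ E]
  {E' : Type*} [NormedAddCommGroup E'] [NormedSpace ℝ E']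

/-- `G` is smooth at `u`, and symmetric and nondegenerate near `u`. -/
structure IsLocalMetricAt (G : E → E →L[ℝ] E →L[ℝ] ℝ) (u : E) : Prop where
  contDiffAt : ContDiffAt ℝ ∞ G u
  symm : ∀ᶠ w in 𝓝 u, ∀ X Y, G w X Y = G w Y X
  isInvertible : ∀ᶠ w in 𝓝 u, (G w).IsInvertible

/-- The gradient in coordinates. -/
noncomputable def gradientLocal (G : E → E →L[ℝ] E →L[ℝ] ℝ) (φ : E → ℝ) (u : E) : E :=
  (G u).inverse (fderiv ℝ φ u)

/-- The coordinate expression of a warped product metric. -/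
noncomputable def warpedLocal (GB : E → E →L[ℝ] E →L[ℝ] ℝ) (GF : E' → E' →L[ℝ] E' →L[ℝ] ℝ)
    (f : E → ℝ) (q : E × E') : E × E' →L[ℝ] E × E' →L[ℝ] ℝ :=
  (GB q.1).bilinearComp (ContinuousLinearMap.fst ℝ E E') (ContinuousLinearMap.fst ℝ E E')
    + (f q.1) ^ 2 • (GF q.2).bilinearComp (ContinuousLinearMap.snd ℝ E E')
        (ContinuousLinearMap.snd ℝ E E')

theorem warpedLocal_apply (GB : E → E →L[ℝ] E →L[ℝ] ℝ) (GF : E' → E' →L[ℝ] E' →L[ℝ] ℝ)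
    (f : E → ℝ) (q A B : E × E') :
    warpedLocal GB GF f q A B = GB q.1 A.1 B.1 + f q.1 ^ 2 * GF q.2 A.2 B.2 := by
  simp [warpedLocal]

/-- Reduces derivatives of form-valued maps to derivatives of scalar functions, where local
identities and product rules apply directly. -/
theorem fderiv_form_apply {F : Type*} [NormedAddCommGroup F] [NormedSpace ℝ F]
    {G : E → E' →L[ℝ] E' →L[ℝ] F} {u : E} (hG : DifferentiableAt ℝ G u) (X : E) (Y Z : E') :
    fderiv ℝ G u X Y Z = fderiv ℝ (fun w => G w Y Z) u X := by
  have h := (hG.hasFDerivAt.clm_apply (hasFDerivAt_const Y u)).clm_apply (hasFDerivAt_const Z u)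
  rw [h.fderiv]
  simp

theorem isInvertible_of_nondegenerate [FiniteDimensional ℝ E] (g : E →L[ℝ] E →L[ℝ] ℝ)
    (hg : ∀ X, (∀ Y, g X Y = 0) → X = 0) : g.IsInvertible := by
  have hinj : Function.Injective (g : E →ₗ[ℝ] (E →L[ℝ] ℝ)) := by
    rw [← LinearMap.ker_eq_bot, LinearMap.ker_eq_bot']
    intro X hX
    refine hg X fun Y => ?_
    have : g X = 0 := hX
    simp [this]
  have hdim : Module.finrank ℝ E = Module.finrank ℝ (E →L[ℝ] ℝ) := by
    rw [← (LinearMap.toContinuousLinearMap : (E →ₗ[ℝ] ℝ) ≃ₗ[ℝ] (E →L[ℝ] ℝ)).finrank_eq]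
    exact (Subspace.dual_finrank_eq (K := ℝ) (V := E)).symm
  refine ⟨(LinearEquiv.ofInjectiveOfFinrankEq _ hinj hdim).toContinuousLinearEquiv, ?_⟩
  ext X Y
  rfl

theorem IsInvertible.eq_zero {g : E →L[ℝ] E →L[ℝ] ℝ} (hg : g.IsInvertible) {X : E}
    (hX : ∀ Y, g X Y = 0) : X = 0 :=
  hg.injective (by ext Y; simpa using hX Y)

theorem metric_christoffel {G : E → E →L[ℝ] E →L[ℝ] ℝ} {u : E} (hG : (G u).IsInvertible)
    (X Y Z : E) : G u (christoffel G u X Y) Z =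
      (fderiv ℝ G u X Y Z + fderiv ℝ G u Y X Z - fderiv ℝ G u Z X Y) / 2 := by
  rw [← christoffelLower_apply]
  simp [christoffel, hG.self_apply_inverse]

/-- Uniqueness in the Koszul formula: nondegeneracy allows a candidate for `∇_X Y` to be checked by
pairing it with every `Z`. -/
theorem christoffel_eq_of_metric {G : E → E →L[ℝ] E →L[ℝ] ℝ} {u : E} (hG : (G u).IsInvertible)
    {X Y A : E} (h : ∀ Z, G u A Z =
      (fderiv ℝ G u X Y Z + fderiv ℝ G u Y X Z - fderiv ℝ G u Z X Y) / 2) :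
    christoffel G u X Y = A := by
  refine hG.injective ?_
  ext Z
  rw [metric_christoffel hG, h]

theorem metric_gradientLocal {G : E → E →L[ℝ] E →L[ℝ] ℝ} {u : E} (hG : (G u).IsInvertible)
    (φ : E → ℝ) (X : E) : G u (gradientLocal G φ u) X = fderiv ℝ φ u X := by
  simp [gradientLocal, hG.self_apply_inverse]

theorem IsLocalMetricAt.fderiv_symm {G : E → E →L[ℝ] E →L[ℝ] ℝ} {u : E}
    (hG : IsLocalMetricAt G u) (X Y Z : E) : fderiv ℝ G u X Y Z = fderiv ℝ G u X Z Y := by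
  have hd := hG.contDiffAt.differentiableAt (by simp)
  rw [fderiv_form_apply hd, fderiv_form_apply hd]
  have : (fun w => G w Y Z) =ᶠ[𝓝 u] fun w => G w Z Y := by
    filter_upwards [hG.symm] with w hw using hw Y Z
  rw [this.fderiv_eq]

theorem IsLocalMetricAt.exists_apply_ne_zero [Nontrivial E] {G : E → E →L[ℝ] E →L[ℝ] ℝ} {u : E}
    (hG : IsLocalMetricAt G u) : ∃ X Y, G u X Y ≠ 0 := by
  obtain ⟨X, hX⟩ := exists_ne (0 : E)
  by_contra! h
  exact hX (IsInvertible.eq_zero hG.isInvertible.self_of_nhds (h X))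

theorem fderiv_comp_prodMk_left {q : E × E'} {F : Type*} [NormedAddCommGroup F] [NormedSpace ℝ F]
    {φ : E × E' → F} (hφ : DifferentiableAt ℝ φ q) (X : E) :
    fderiv ℝ (fun w => φ (w, q.2)) q.1 X = fderiv ℝ φ q (X, 0) := by
  have h : HasFDerivAt (fun w : E => (w, q.2)) (ContinuousLinearMap.inl ℝ E E') q.1 :=
    hasFDerivAt_prodMk_left q.1 q.2
  have h' := (HasFDerivAt.comp (g := φ) q.1 hφ.hasFDerivAt h).fderiv
  exact congrArg (fun L => L X) h'

theorem fderiv_comp_prodMk_right {q : E × E'} {F : Type*} [NormedAddCommGroup F] [NormedSpace ℝ F]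
    {φ : E × E' → F} (hφ : DifferentiableAt ℝ φ q) (X : E') :
    fderiv ℝ (fun w => φ (q.1, w)) q.2 X = fderiv ℝ φ q (0, X) := by
  have h : HasFDerivAt (fun w : E' => (q.1, w)) (ContinuousLinearMap.inr ℝ E E') q.2 :=
    hasFDerivAt_prodMk_right q.1 q.2
  have h' := (HasFDerivAt.comp (g := φ) q.2 hφ.hasFDerivAt h).fderiv
  exact congrArg (fun L => L X) h'

theorem eventually_differentiableAt_of_contDiffAt {F : Type*} [NormedAddCommGroup F]
    [NormedSpace ℝ F] {φ : E → F} {u : E} (hφ : ContDiffAt ℝ ∞ φ u) :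
    ∀ᶠ w in 𝓝 u, DifferentiableAt ℝ φ w := by
  have h1 : ContDiffAt ℝ 1 φ u := hφ.of_le (by exact_mod_cast le_top)
  filter_upwards [h1.eventually (by simp)] with w hw
  exact hw.differentiableAt (by simp)

section Smooth

variable [FiniteDimensional ℝ E]

theorem IsLocalMetricAt.contDiffAt_inverse {G : E → E →L[ℝ] E →L[ℝ] ℝ} {u : E}
    (hG : IsLocalMetricAt G u) : ContDiffAt ℝ ∞ (fun w => (G w).inverse) u := by
  have : CompleteSpace E := FiniteDimensional.complete ℝ E
  exact (hG.isInvertible.self_of_nhds.contDiffAt_map_inverse).comp u hG.contDiffAt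

theorem IsLocalMetricAt.contDiffAt_christoffel {G : E → E →L[ℝ] E →L[ℝ] ℝ} {u : E}
    (hG : IsLocalMetricAt G u) : ContDiffAt ℝ ∞ (christoffel G) u := by
  have hD : ContDiffAt ℝ ∞ (fderiv ℝ G) u := hG.contDiffAt.fderiv_right (by simp)
  have hflip : ContDiffAt ℝ ∞ (fun w => (fderiv ℝ G w).flip) u :=
    (ContinuousLinearMap.flipₗᵢ ℝ E E (E →L[ℝ] ℝ)).contDiff.contDiffAt.comp u hD
  have hlow : ContDiffAt ℝ ∞ (christoffelLower G) u := by
    unfold christoffelLower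
    exact ((hD.add hflip).sub (contDiffAt_const.clm_comp hflip)).const_smul (1 / 2 : ℝ)
  have hinv : ContDiffAt ℝ ∞
      (fun w => ContinuousLinearMap.compL ℝ E (E →L[ℝ] ℝ) E (G w).inverse) u :=
    (ContinuousLinearMap.compL ℝ E (E →L[ℝ] ℝ) E).contDiff.contDiffAt.comp u hG.contDiffAt_inverse
  exact hinv.clm_comp hlow

theorem IsLocalMetricAt.contDiffAt_gradientLocal {G : E → E →L[ℝ] E →L[ℝ] ℝ} {u : E}
    (hG : IsLocalMetricAt G u) {φ : E → ℝ} (hφ : ContDiffAt ℝ ∞ φ u) :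
    ContDiffAt ℝ ∞ (gradientLocal G φ) u :=
  hG.contDiffAt_inverse.clm_apply (hφ.fderiv_right (by simp))

/-- `G(∇_X grad φ, Y) = H^φ(X, Y)`. -/
theorem IsLocalMetricAt.metric_covariantDeriv_gradientLocal {G : E → E →L[ℝ] E →L[ℝ] ℝ} {u : E}
    (hG : IsLocalMetricAt G u) {φ : E → ℝ} (hφ : ContDiffAt ℝ ∞ φ u) (X Y : E) :
    G u (fderiv ℝ (gradientLocal G φ) u X + christoffel G u X (gradientLocal G φ u)) Y
      = hessianLocal G φ u X Y := by
  have hi := hG.isInvertible.self_of_nhds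
  have hs := hG.symm.self_of_nhds
  have hd := hG.contDiffAt.differentiableAt (by simp)
  have hn := (hG.contDiffAt_gradientLocal hφ).differentiableAt (by simp)
  have hφ' : DifferentiableAt ℝ (fderiv ℝ φ) u :=
    (hφ.fderiv_right (m := ∞) (by simp)).differentiableAt (by simp)
  -- Differentiate `G(grad φ, Y) = dφ(Y)` with `Y` constant. The derivative of `G` that appears is
  -- then absorbed by the two Christoffel terms.
  have key : fderiv ℝ (fun w => G w (gradientLocal G φ w) Y) u X = fderiv ℝ (fderiv ℝ φ) u X Y := by
    have : (fun w => G w (gradientLocal G φ w) Y) =ᶠ[𝓝 u] fun w => fderiv ℝ φ w Y := by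
      filter_upwards [hG.isInvertible] with w hw using metric_gradientLocal hw φ Y
    rw [this.fderiv_eq, (hφ'.hasFDerivAt.clm_apply (hasFDerivAt_const Y u)).fderiv]
    simp
  rw [((hd.hasFDerivAt.clm_apply hn.hasFDerivAt).clm_apply (hasFDerivAt_const Y u)).fderiv] at key
  simp at key
  have h1 : fderiv ℝ φ u (christoffel G u X Y) = G u (christoffel G u X Y) (gradientLocal G φ u) := by
    rw [hs, metric_gradientLocal hi]
  simp only [hessianLocal, LinearMap.mk₂_apply, map_add, add_apply]
  rw [h1, metric_christoffel hi, metric_christoffel hi, ← key]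
  rw [hG.fderiv_symm X Y, hG.fderiv_symm Y X, hG.fderiv_symm (gradientLocal G φ u) X Y]
  ring

end Smooth

theorem hessianLocal_apply (G : E → E →L[ℝ] E →L[ℝ] ℝ) (φ : E → ℝ) (u X Y : E) :
    hessianLocal G φ u X Y
      = fderiv ℝ (fderiv ℝ φ) u X Y - fderiv ℝ φ u (christoffel G u X Y) := rfl

section Congr

variable {G G' : E → E →L[ℝ] E →L[ℝ] ℝ} {u : E}

theorem christoffel_congr (h : G' =ᶠ[𝓝 u] G) : christoffel G' =ᶠ[𝓝 u] christoffel G := by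
  filter_upwards [h, h.fderiv (𝕜 := ℝ)] with w h1 h2
  simp only [christoffel, christoffelLower, h1, h2]

/-- Curvature depends only on the germ of the metric. This suffices because the chart expression of
a warped metric is known only near the base point. -/
theorem curvatureLocal_congr (h : G' =ᶠ[𝓝 u] G) : curvatureLocal G' u = curvatureLocal G u := by
  have hc := christoffel_congr h
  ext X Y Z
  simp only [curvatureLocal, hc.fderiv_eq, hc.eq_of_nhds]

end Congr

end LocalMetric

/-! ### Smoothness of pulled-back forms -/

section BilinearComp

variable {D V W : Type*} [NormedAddCommGroup D] [NormedSpace ℝ D] [NormedAddCommGroup V]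
  [NormedSpace ℝ V] [NormedAddCommGroup W] [NormedSpace ℝ W]

theorem _root_.ContDiffAt.bilinearComp {n : ℕ∞ω} {g : D → V →L[ℝ] V →L[ℝ] ℝ}
    {l : D → W →L[ℝ] V} {q : D} (hg : ContDiffAt ℝ n g q) (hl : ContDiffAt ℝ n l q) :
    ContDiffAt ℝ n (fun w => (g w).bilinearComp (l w) (l w)) q := by
  have h1 : ContDiffAt ℝ n (fun w => (g w).comp (l w)) q := hg.clm_comp hl
  have h2 : ContDiffAt ℝ n (fun w => ((g w).comp (l w)).flip) q :=
    (ContinuousLinearMap.flipₗᵢ ℝ W V ℝ).contDiff.contDiffAt.comp q h1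
  have h3 : ContDiffAt ℝ n (fun w => (((g w).comp (l w)).flip).comp (l w)) q := h2.clm_comp hl
  exact (ContinuousLinearMap.flipₗᵢ ℝ W W ℝ).contDiff.contDiffAt.comp q h3

end BilinearComp

/-! ### Connection of a warped product and its derivative -/

section WarpedLocal

variable {E : Type*} [NormedAddCommGroup E] [NormedSpace ℝ E] [FiniteDimensional ℝ E]
  {E' : Type*} [NormedAddCommGroup E'] [NormedSpace ℝ E'] [FiniteDimensional ℝ E']
  {GB : E → E →L[ℝ] E →L[ℝ] ℝ} {GF : E' → E' →L[ℝ] E' →L[ℝ] ℝ} {f : E → ℝ} {q : E × E'}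

theorem IsLocalMetricAt.warped (hB : IsLocalMetricAt GB q.1) (hF : IsLocalMetricAt GF q.2)
    (hf : ContDiffAt ℝ ∞ f q.1) (hf0 : f q.1 ≠ 0) : IsLocalMetricAt (warpedLocal GB GF f) q where
  contDiffAt := by
    have hff : ContDiffAt ℝ ∞ (fun w : E × E' => f w.1 ^ 2) q :=
      (hf.comp q contDiffAt_fst).pow 2
    have hB' : ContDiffAt ℝ ∞ (fun w : E × E' => GB w.1) q := hB.contDiffAt.comp q contDiffAt_fst
    have hF' : ContDiffAt ℝ ∞ (fun w : E × E' => GF w.2) q := hF.contDiffAt.comp q contDiffAt_snd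
    exact (hB'.bilinearComp contDiffAt_const).add (hff.smul (hF'.bilinearComp contDiffAt_const))
  symm := by
    filter_upwards [continuousAt_fst.eventually hB.symm,
      continuousAt_snd.eventually hF.symm] with w h1 h2 X Y
    rw [warpedLocal_apply, warpedLocal_apply, h1 X.1, h2 X.2]
  isInvertible := by
    have h0 : ∀ᶠ w in 𝓝 q, f (Prod.fst w) ≠ 0 :=
      (hf.continuousAt.comp (x := q) continuousAt_fst).eventually_ne hf0
    filter_upwards [continuousAt_fst.eventually hB.isInvertible,
      continuousAt_snd.eventually hF.isInvertible, h0] with w h1 h2 h3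
    refine isInvertible_of_nondegenerate _ fun X hX => ?_
    refine Prod.ext (IsInvertible.eq_zero h1 fun Y => ?_) (IsInvertible.eq_zero h2 fun Y => ?_)
    · simpa [warpedLocal_apply] using hX (Y, 0)
    · simpa [warpedLocal_apply, h3] using hX (0, Y)

theorem fderiv_warpedLocal (hB : DifferentiableAt ℝ GB q.1) (hF : DifferentiableAt ℝ GF q.2)
    (hf : DifferentiableAt ℝ f q.1) (hW : DifferentiableAt ℝ (warpedLocal GB GF f) q)
    (A B C : E × E') :
    fderiv ℝ (warpedLocal GB GF f) q A B C = fderiv ℝ GB q.1 A.1 B.1 C.1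
      + 2 * f q.1 * fderiv ℝ f q.1 A.1 * GF q.2 B.2 C.2
      + f q.1 ^ 2 * fderiv ℝ GF q.2 A.2 B.2 C.2 := by
  rw [fderiv_form_apply hW]
  simp only [warpedLocal_apply]
  have h1 : HasFDerivAt (fun w : E × E' => GB w.1) _ q := hB.hasFDerivAt.comp q hasFDerivAt_fst
  have h2 : HasFDerivAt (fun w : E × E' => GF w.2) _ q := hF.hasFDerivAt.comp q hasFDerivAt_snd
  have h3 : HasFDerivAt (fun w : E × E' => f w.1) _ q := hf.hasFDerivAt.comp q hasFDerivAt_fst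
  have h := ((h1.clm_apply (hasFDerivAt_const B.1 q)).clm_apply (hasFDerivAt_const C.1 q)).add
    ((h3.pow 2).mul ((h2.clm_apply (hasFDerivAt_const B.2 q)).clm_apply (hasFDerivAt_const C.2 q)))
  have h' := congrArg (fun L => L A) h.fderiv
  refine h'.trans ?_
  simp
  ring

/-- The Levi-Civita connection of a warped product. -/
theorem christoffel_warpedLocal (hB : IsLocalMetricAt GB q.1) (hF : IsLocalMetricAt GF q.2)
    (hf : ContDiffAt ℝ ∞ f q.1) (hf0 : f q.1 ≠ 0) (A B : E × E') :
    christoffel (warpedLocal GB GF f) q A B =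
      (christoffel GB q.1 A.1 B.1 - (f q.1 * GF q.2 A.2 B.2) • gradientLocal GB f q.1,
        christoffel GF q.2 A.2 B.2 + (fderiv ℝ f q.1 A.1 / f q.1) • B.2
          + (fderiv ℝ f q.1 B.1 / f q.1) • A.2) := by
  have hW := hB.warped hF hf hf0
  refine christoffel_eq_of_metric hW.isInvertible.self_of_nhds fun Z => ?_
  have hd := fderiv_warpedLocal (hB.contDiffAt.differentiableAt (by simp))
    (hF.contDiffAt.differentiableAt (by simp)) (hf.differentiableAt (by simp))
    (hW.contDiffAt.differentiableAt (by simp))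
  rw [hd, hd, hd, warpedLocal_apply]
  simp only [map_add, map_sub, map_smul, add_apply, sub_apply, smul_apply,
    smul_eq_mul, metric_christoffel hB.isInvertible.self_of_nhds,
    metric_christoffel hF.isInvertible.self_of_nhds,
    metric_gradientLocal hB.isInvertible.self_of_nhds]
  field_simp
  ring

theorem eventuallyEq_christoffel_warpedLocal
    (hB : ∀ᶠ w in 𝓝 q.1, IsLocalMetricAt GB w) (hF : ∀ᶠ w in 𝓝 q.2, IsLocalMetricAt GF w)
    (hf : ∀ᶠ w in 𝓝 q.1, ContDiffAt ℝ ∞ f w) (hf0 : f q.1 ≠ 0) (A B : E × E') :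
    (fun w => christoffel (warpedLocal GB GF f) w A B) =ᶠ[𝓝 q] fun w =>
      (christoffel GB w.1 A.1 B.1 - (f w.1 * GF w.2 A.2 B.2) • gradientLocal GB f w.1,
        christoffel GF w.2 A.2 B.2 + (fderiv ℝ f w.1 A.1 / f w.1) • B.2
          + (fderiv ℝ f w.1 B.1 / f w.1) • A.2) := by
  have h0 : ∀ᶠ w in 𝓝 q, f (Prod.fst w) ≠ 0 :=
    (hf.self_of_nhds.continuousAt.comp (x := q) continuousAt_fst).eventually_ne hf0
  filter_upwards [continuousAt_fst.eventually hB, continuousAt_snd.eventually hF,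
    continuousAt_fst.eventually hf, h0] with w h1 h2 h3 h4
  exact christoffel_warpedLocal h1 h2 h3 h4 A B

/-- Curvature needs one derivative of the connection, so the connection formula must hold on a
neighbourhood; hence the eventual hypotheses here and below. -/
theorem fderiv_christoffel_warpedLocal
    (hB : ∀ᶠ w in 𝓝 q.1, IsLocalMetricAt GB w) (hF : ∀ᶠ w in 𝓝 q.2, IsLocalMetricAt GF w)
    (hf : ∀ᶠ w in 𝓝 q.1, ContDiffAt ℝ ∞ f w) (hf0 : f q.1 ≠ 0) (C A B : E × E') :
    fderiv ℝ (christoffel (warpedLocal GB GF f)) q C A B =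
      (fderiv ℝ (christoffel GB) q.1 C.1 A.1 B.1
        - (fderiv ℝ f q.1 C.1 * GF q.2 A.2 B.2 + f q.1 * fderiv ℝ GF q.2 C.2 A.2 B.2)
            • gradientLocal GB f q.1
        - (f q.1 * GF q.2 A.2 B.2) • fderiv ℝ (gradientLocal GB f) q.1 C.1,
       fderiv ℝ (christoffel GF) q.2 C.2 A.2 B.2
        + (fderiv ℝ (fderiv ℝ f) q.1 C.1 A.1 / f q.1
            - fderiv ℝ f q.1 C.1 * fderiv ℝ f q.1 A.1 / f q.1 ^ 2) • B.2
        + (fderiv ℝ (fderiv ℝ f) q.1 C.1 B.1 / f q.1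
            - fderiv ℝ f q.1 C.1 * fderiv ℝ f q.1 B.1 / f q.1 ^ 2) • A.2) := by
  have hB' := hB.self_of_nhds
  have hF' := hF.self_of_nhds
  have hf' := hf.self_of_nhds
  have hW := (hB'.warped hF' hf' hf0).contDiffAt_christoffel.differentiableAt (by simp)
  rw [fderiv_form_apply hW,
    (eventuallyEq_christoffel_warpedLocal hB hF hf hf0 A B).fderiv_eq]
  have hΓB := hB'.contDiffAt_christoffel.differentiableAt (by simp)
  have hΓF := hF'.contDiffAt_christoffel.differentiableAt (by simp)
  have hGF := hF'.contDiffAt.differentiableAt (by simp)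
  have hN := (hB'.contDiffAt_gradientLocal hf').differentiableAt (by simp)
  have hdf := hf'.differentiableAt (by simp)
  have hddf : DifferentiableAt ℝ (fderiv ℝ f) q.1 :=
    (hf'.fderiv_right (m := ∞) (by simp)).differentiableAt (by simp)
  have h1 : HasFDerivAt (fun w : E × E' => christoffel GB w.1) _ q :=
    hΓB.hasFDerivAt.comp q hasFDerivAt_fst
  have h2 : HasFDerivAt (fun w : E × E' => christoffel GF w.2) _ q :=
    hΓF.hasFDerivAt.comp q hasFDerivAt_snd
  have h3 : HasFDerivAt (fun w : E × E' => GF w.2) _ q := hGF.hasFDerivAt.comp q hasFDerivAt_snd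
  have h4 : HasFDerivAt (fun w : E × E' => gradientLocal GB f w.1) _ q :=
    hN.hasFDerivAt.comp q hasFDerivAt_fst
  have h5 : HasFDerivAt (fun w : E × E' => f w.1) _ q := hdf.hasFDerivAt.comp q hasFDerivAt_fst
  have h6 : HasFDerivAt (fun w : E × E' => fderiv ℝ f w.1) _ q :=
    hddf.hasFDerivAt.comp q hasFDerivAt_fst
  have h7 : HasFDerivAt (fun w : E × E' => (f w.1)⁻¹) _ q :=
    (hasDerivAt_inv hf0).comp_hasFDerivAt q h5
  have hc (v : E) : HasFDerivAt (fun _ : E × E' => v) _ q := hasFDerivAt_const (𝕜 := ℝ) v q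
  have hc' (v : E') : HasFDerivAt (fun _ : E × E' => v) _ q := hasFDerivAt_const (𝕜 := ℝ) v q
  have h := HasFDerivAt.prodMk
    (((h1.clm_apply (hc A.1)).clm_apply (hc B.1)).sub
      ((h5.mul ((h3.clm_apply (hc' A.2)).clm_apply (hc' B.2))).smul h4))
    ((((h2.clm_apply (hc' A.2)).clm_apply (hc' B.2)).add
      (((h6.clm_apply (hc A.1)).mul h7).smul (hc' B.2))).add
      (((h6.clm_apply (hc B.1)).mul h7).smul (hc' A.2)))
  have h' := congrArg (fun L => L C) h.fderiv
  refine Eq.trans ?_ (h'.trans ?_)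
  · simp only [div_eq_mul_inv]
    rfl
  · ext
    · simp
      module
    · simp
      congr 2
      · ring_nf
      · ring_nf

end WarpedLocal

/-! ### Curvature and Hessians of a warped product -/

section WarpedCurvature

variable {E : Type*} [NormedAddCommGroup E] [NormedSpace ℝ E] [FiniteDimensional ℝ E]
  {E' : Type*} [NormedAddCommGroup E'] [NormedSpace ℝ E'] [FiniteDimensional ℝ E']
  {GB : E → E →L[ℝ] E →L[ℝ] ℝ} {GF : E' → E' →L[ℝ] E' →L[ℝ] ℝ} {f : E → ℝ} {q : E × E'}

theorem curvatureLocal_warpedLocal_base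
    (hB : ∀ᶠ w in 𝓝 q.1, IsLocalMetricAt GB w) (hF : ∀ᶠ w in 𝓝 q.2, IsLocalMetricAt GF w)
    (hf : ∀ᶠ w in 𝓝 q.1, ContDiffAt ℝ ∞ f w) (hf0 : f q.1 ≠ 0) (X Y Z : E) :
    curvatureLocal (warpedLocal GB GF f) q (X, 0) (Y, 0) (Z, 0)
      = (curvatureLocal GB q.1 X Y Z, 0) := by
  have hΓ := christoffel_warpedLocal hB.self_of_nhds hF.self_of_nhds hf.self_of_nhds hf0
  have hD := fderiv_christoffel_warpedLocal hB hF hf hf0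
  simp only [curvatureLocal, hΓ, hD]
  ext <;> simp

theorem curvatureLocal_warpedLocal_mixed_base
    (hB : ∀ᶠ w in 𝓝 q.1, IsLocalMetricAt GB w) (hF : ∀ᶠ w in 𝓝 q.2, IsLocalMetricAt GF w)
    (hf : ∀ᶠ w in 𝓝 q.1, ContDiffAt ℝ ∞ f w) (hf0 : f q.1 ≠ 0) (X Y : E) (V : E') :
    curvatureLocal (warpedLocal GB GF f) q (X, 0) (0, V) (Y, 0)
      = (0, (hessianLocal GB f q.1 X Y / f q.1) • V) := by
  have hΓ := christoffel_warpedLocal hB.self_of_nhds hF.self_of_nhds hf.self_of_nhds hf0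
  have hD := fderiv_christoffel_warpedLocal hB hF hf hf0
  simp only [curvatureLocal, hΓ, hD, hessianLocal_apply]
  ext
  · simp
  · simp
    rw [smul_smul, ← add_smul, ← sub_smul]
    congr 1
    field_simp
    ring

/-- The base vector is `∇_X grad f`; pairing it with `Y` through `GB` turns it into the Hessian of
`f`. -/
theorem curvatureLocal_warpedLocal_mixed_fiber
    (hB : ∀ᶠ w in 𝓝 q.1, IsLocalMetricAt GB w) (hF : ∀ᶠ w in 𝓝 q.2, IsLocalMetricAt GF w)
    (hf : ∀ᶠ w in 𝓝 q.1, ContDiffAt ℝ ∞ f w) (hf0 : f q.1 ≠ 0) (X : E) (V W : E') :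
    curvatureLocal (warpedLocal GB GF f) q (X, 0) (0, V) (0, W)
      = (-(f q.1 * GF q.2 V W) • (fderiv ℝ (gradientLocal GB f) q.1 X
          + christoffel GB q.1 X (gradientLocal GB f q.1)), 0) := by
  have hΓ := christoffel_warpedLocal hB.self_of_nhds hF.self_of_nhds hf.self_of_nhds hf0
  have hD := fderiv_christoffel_warpedLocal hB hF hf hf0
  simp only [curvatureLocal, hΓ, hD]
  ext
  · simp
    match_scalars <;> field_simp
    ring
  · simp

/-- This is the Gauss equation of the fibre: the correction comes from its second fundamental form,
which is proportional to `grad f`. Only the fibre component is needed to recover the curvature of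
the fibre. -/
theorem snd_curvatureLocal_warpedLocal_fiber
    (hB : ∀ᶠ w in 𝓝 q.1, IsLocalMetricAt GB w) (hF : ∀ᶠ w in 𝓝 q.2, IsLocalMetricAt GF w)
    (hf : ∀ᶠ w in 𝓝 q.1, ContDiffAt ℝ ∞ f w) (hf0 : f q.1 ≠ 0) (U V W : E') :
    (curvatureLocal (warpedLocal GB GF f) q (0, U) (0, V) (0, W)).2
      = curvatureLocal GF q.2 U V W - fderiv ℝ f q.1 (gradientLocal GB f q.1) •
          (GF q.2 V W • U - GF q.2 U W • V) := by
  have hΓ := christoffel_warpedLocal hB.self_of_nhds hF.self_of_nhds hf.self_of_nhds hf0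
  have hD := fderiv_christoffel_warpedLocal hB hF hf hf0
  simp only [curvatureLocal, hΓ, hD]
  simp
  match_scalars <;> field_simp

/-- If the curvature of a warped product has the form `θ(B,C)A - θ(A,C)B`, then `θ` is a multiple
of the metric, and base, fiber and warping function satisfy the constant curvature equations. -/
theorem exists_of_curvatureLocal_warpedLocal [Nontrivial E] [Nontrivial E']
    (hB : ∀ᶠ w in 𝓝 q.1, IsLocalMetricAt GB w) (hF : ∀ᶠ w in 𝓝 q.2, IsLocalMetricAt GF w)
    (hf : ∀ᶠ w in 𝓝 q.1, ContDiffAt ℝ ∞ f w) (hf0 : f q.1 ≠ 0)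
    (θ : LinearMap.BilinForm ℝ (E × E'))
    (hθ : ∀ A B C, curvatureLocal (warpedLocal GB GF f) q A B C = θ B C • A - θ A C • B) :
    ∃ κ : ℝ, (∀ A B, θ A B = κ * warpedLocal GB GF f q A B) ∧
      (∀ X Y, hessianLocal GB f q.1 X Y = -(κ * f q.1) * GB q.1 X Y) ∧
      (∀ X Y Z, curvatureLocal GB q.1 X Y Z = κ • (GB q.1 Y Z • X - GB q.1 X Z • Y)) ∧
      (∀ U V W, curvatureLocal GF q.2 U V W
        = (κ * f q.1 ^ 2 + fderiv ℝ f q.1 (gradientLocal GB f q.1)) •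
            (GF q.2 V W • U - GF q.2 U W • V)) := by
  obtain ⟨X₀, Y₀, h₀⟩ := hB.self_of_nhds.exists_apply_ne_zero
  obtain ⟨V₀, W₀, h₁⟩ := hF.self_of_nhds.exists_apply_ne_zero
  obtain ⟨X₁, hX₁⟩ := exists_ne (0 : E)
  obtain ⟨V₁, hV₁⟩ := exists_ne (0 : E')
  -- `R(X₁,V)Y` has no base component, whereas `θ` predicts `θ(V,Y) X₁`. Symmetry of `θ` is not
  -- assumed, so the two mixed blocks are treated separately.
  have hFB : ∀ V Y, θ (0, V) (Y, 0) = 0 := fun V Y => by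
    have h := curvatureLocal_warpedLocal_mixed_base hB hF hf hf0 X₁ Y V
    rw [hθ] at h
    have h := congrArg Prod.fst h
    simpa [hX₁] using h
  have hBB : ∀ X Y, hessianLocal GB f q.1 X Y = -(f q.1 * θ (X, 0) (Y, 0)) := fun X Y => by
    have h := curvatureLocal_warpedLocal_mixed_base hB hF hf hf0 X Y V₁
    rw [hθ] at h
    have h := congrArg Prod.snd h
    simp only [Prod.snd_sub, Prod.smul_snd, smul_zero, zero_sub, ← neg_smul] at h
    have h := smul_left_injective ℝ hV₁ h
    field_simp at h
    linarith
  have hBF : ∀ X W, θ (X, 0) (0, W) = 0 := fun X W => by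
    have h := curvatureLocal_warpedLocal_mixed_fiber hB hF hf hf0 X V₁ W
    rw [hθ] at h
    have h := congrArg Prod.snd h
    simpa [hV₁] using h
  have hFF : ∀ V W X Y, θ (0, V) (0, W) * GB q.1 X Y
      = -(f q.1 * GF q.2 V W * hessianLocal GB f q.1 X Y) := fun V W X Y => by
    have h := curvatureLocal_warpedLocal_mixed_fiber hB hF hf hf0 X V W
    rw [hθ] at h
    have h := congrArg (fun A => GB q.1 A.1 Y) h
    simp only [Prod.fst_sub, Prod.smul_fst, smul_zero, sub_zero, map_smul, smul_apply,
      smul_eq_mul, hB.self_of_nhds.metric_covariantDeriv_gradientLocal hf.self_of_nhds] at h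
    linarith
  -- Separation of variables in `hFF`: fixing fibre vectors with `GF(V₀,W₀) ≠ 0` shows that the
  -- Hessian is a multiple of `GB`. The normalisation is chosen so that `θ(V₀,W₀) = κ f² GF(V₀,W₀)`.
  set κ : ℝ := θ (0, V₀) (0, W₀) / (f q.1 ^ 2 * GF q.2 V₀ W₀) with hκ
  have hH : ∀ X Y, hessianLocal GB f q.1 X Y = -(κ * f q.1) * GB q.1 X Y := fun X Y => by
    have h := hFF V₀ W₀ X Y
    rw [hκ]
    field_simp
    linarith
  have hBB' : ∀ X Y, θ (X, 0) (Y, 0) = κ * GB q.1 X Y := fun X Y => by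
    have h := (hBB X Y).symm.trans (hH X Y)
    have : f q.1 * θ (X, 0) (Y, 0) = f q.1 * (κ * GB q.1 X Y) := by linarith
    exact mul_left_cancel₀ hf0 this
  -- The other half of the separation: now base vectors with `GB(X₀,Y₀) ≠ 0` are fixed and
  -- cancelled.
  have hFF' : ∀ V W, θ (0, V) (0, W) = κ * (f q.1 ^ 2 * GF q.2 V W) := fun V W => by
    have h := hFF V W X₀ Y₀
    rw [hH] at h
    refine mul_right_cancel₀ h₀ (h.trans (by ring))
  have hθW : ∀ A B, θ A B = κ * warpedLocal GB GF f q A B := fun A B => by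
    have hA : A = (A.1, 0) + (0, A.2) := by simp
    have hB : B = (B.1, 0) + (0, B.2) := by simp
    conv_lhs => rw [hA, hB]
    simp only [map_add, LinearMap.add_apply, hBB', hFF', hBF, hFB, warpedLocal_apply]
    ring
  refine ⟨κ, hθW, hH, fun X Y Z => ?_, fun U V W => ?_⟩
  · have h := curvatureLocal_warpedLocal_base hB hF hf hf0 X Y Z
    rw [hθ] at h
    have h := congrArg Prod.fst h
    simp only [Prod.fst_sub, Prod.smul_fst, hBB'] at h
    rw [← h, smul_sub, smul_smul, smul_smul]
  · have h := snd_curvatureLocal_warpedLocal_fiber hB hF hf hf0 U V W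
    rw [hθ] at h
    simp only [Prod.snd_sub, Prod.smul_snd, hFF'] at h
    rw [eq_comm, sub_eq_iff_eq_add] at h
    rw [h]
    module

/-- Base slices are totally geodesic: the connection of two base vectors has no fibre component, so
no correction term arises. -/
theorem hessianLocal_warpedLocal_base (hB : IsLocalMetricAt GB q.1) (hF : IsLocalMetricAt GF q.2)
    (hf : ContDiffAt ℝ ∞ f q.1) (hf0 : f q.1 ≠ 0) {φ : E × E' → ℝ} (hφ : ContDiffAt ℝ ∞ φ q)
    (X Y : E) : hessianLocal (warpedLocal GB GF f) φ q (X, 0) (Y, 0)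
      = hessianLocal GB (fun w => φ (w, q.2)) q.1 X Y := by
  have hd := hφ.differentiableAt (by simp)
  have hdd : DifferentiableAt ℝ (fderiv ℝ φ) q :=
    (hφ.fderiv_right (m := ∞) (by simp)).differentiableAt (by simp)
  have hψ : ContDiffAt ℝ ∞ (fun w => φ (w, q.2)) q.1 :=
    ContDiffAt.comp (g := φ) q.1 hφ (contDiffAt_id.prodMk contDiffAt_const)
  have hψ' : DifferentiableAt ℝ (fderiv ℝ fun w => φ (w, q.2)) q.1 :=
    (hψ.fderiv_right (m := ∞) (by simp)).differentiableAt (by simp)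
  have h2 : fderiv ℝ (fderiv ℝ fun w => φ (w, q.2)) q.1 X Y
      = fderiv ℝ (fderiv ℝ φ) q (X, 0) (Y, 0) := by
    rw [← fderiv_comp_prodMk_left hdd]
    have e : (fun w => fderiv ℝ (fun w => φ (w, q.2)) w Y)
        =ᶠ[𝓝 q.1] fun w => fderiv ℝ φ (w, q.2) (Y, 0) := by
      have : Tendsto (fun w : E => (w, q.2)) (𝓝 q.1) (𝓝 q) :=
        (continuous_id.prodMk continuous_const).tendsto' _ _ rfl
      filter_upwards [this.eventually (eventually_differentiableAt_of_contDiffAt hφ)] with w hw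
      exact fderiv_comp_prodMk_left (q := (w, q.2)) hw Y
    have e1 := e.fderiv_eq (𝕜 := ℝ)
    rw [(hψ'.hasFDerivAt.clm_apply (hasFDerivAt_const Y q.1)).fderiv] at e1
    have hc : DifferentiableAt ℝ (fun w => fderiv ℝ φ (w, q.2)) q.1 :=
      DifferentiableAt.comp (g := fderiv ℝ φ) q.1 hdd
        (differentiableAt_id.prodMk (differentiableAt_const q.2))
    rw [(hc.hasFDerivAt.clm_apply (hasFDerivAt_const ((Y, 0) : E × E') q.1)).fderiv] at e1
    simpa using congrArg (fun L => L X) e1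
  rw [hessianLocal_apply, hessianLocal_apply, h2, fderiv_comp_prodMk_left hd,
    christoffel_warpedLocal hB hF hf hf0]
  simp

/-- Fibres are not totally geodesic: `∇_U V` has base component `-f GF(U,V) grad f`, which produces
the extra term. -/
theorem hessianLocal_warpedLocal_fiber (hB : IsLocalMetricAt GB q.1) (hF : IsLocalMetricAt GF q.2)
    (hf : ContDiffAt ℝ ∞ f q.1) (hf0 : f q.1 ≠ 0) {φ : E × E' → ℝ} (hφ : ContDiffAt ℝ ∞ φ q)
    (U V : E') : hessianLocal (warpedLocal GB GF f) φ q (0, U) (0, V)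
      = hessianLocal GF (fun w => φ (q.1, w)) q.2 U V
        + f q.1 * GF q.2 U V
          * fderiv ℝ (fun w => φ (w, q.2)) q.1 (gradientLocal GB f q.1) := by
  have hd := hφ.differentiableAt (by simp)
  have hdd : DifferentiableAt ℝ (fderiv ℝ φ) q :=
    (hφ.fderiv_right (m := ∞) (by simp)).differentiableAt (by simp)
  have hψ : ContDiffAt ℝ ∞ (fun w => φ (q.1, w)) q.2 :=
    ContDiffAt.comp (g := φ) q.2 hφ (contDiffAt_const.prodMk contDiffAt_id)
  have hψ' : DifferentiableAt ℝ (fderiv ℝ fun w => φ (q.1, w)) q.2 :=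
    (hψ.fderiv_right (m := ∞) (by simp)).differentiableAt (by simp)
  have h2 : fderiv ℝ (fderiv ℝ fun w => φ (q.1, w)) q.2 U V
      = fderiv ℝ (fderiv ℝ φ) q (0, U) (0, V) := by
    rw [← fderiv_comp_prodMk_right hdd]
    have e : (fun w => fderiv ℝ (fun w => φ (q.1, w)) w V)
        =ᶠ[𝓝 q.2] fun w => fderiv ℝ φ (q.1, w) (0, V) := by
      have : Tendsto (fun w : E' => (q.1, w)) (𝓝 q.2) (𝓝 q) :=
        (continuous_const.prodMk continuous_id).tendsto' _ _ rfl
      filter_upwards [this.eventually (eventually_differentiableAt_of_contDiffAt hφ)] with w hw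
      exact fderiv_comp_prodMk_right (q := (q.1, w)) hw V
    have e1 := e.fderiv_eq (𝕜 := ℝ)
    rw [(hψ'.hasFDerivAt.clm_apply (hasFDerivAt_const V q.2)).fderiv] at e1
    have hc : DifferentiableAt ℝ (fun w => fderiv ℝ φ (q.1, w)) q.2 :=
      DifferentiableAt.comp (g := fderiv ℝ φ) q.2 hdd
        ((differentiableAt_const q.1).prodMk differentiableAt_id)
    rw [(hc.hasFDerivAt.clm_apply (hasFDerivAt_const ((0, V) : E × E') q.2)).fderiv] at e1
    simpa using congrArg (fun L => L U) e1
  rw [hessianLocal_apply, hessianLocal_apply, h2, fderiv_comp_prodMk_right hd,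
    fderiv_comp_prodMk_left hd, christoffel_warpedLocal hB hF hf hf0]
  have e (N : E) (W : E') (c : ℝ) : ((-(c • N), W) : E × E') = (0, W) - c • (N, 0) := by
    ext <;> simp
  simp only [map_zero, zero_div, zero_smul, add_zero, zero_sub, e, map_sub,
    map_smul, smul_eq_mul]
  ring

end WarpedCurvature

/-! ### Traces in the constant-curvature case -/

section Trace

variable {E : Type*} [NormedAddCommGroup E] [NormedSpace ℝ E] [FiniteDimensional ℝ E]

theorem metricTrace_eq {g : E →L[ℝ] E →L[ℝ] ℝ} (hg : g.IsInvertible)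
    {B : LinearMap.BilinForm ℝ E} {c : ℝ} (h : ∀ X Y, B X Y = c * g X Y) :
    metricTrace g B = c * Module.finrank ℝ E := by
  have : ((g.inverse : (E →L[ℝ] ℝ) →ₗ[ℝ] E) ∘ₗ
      (LinearMap.toContinuousLinearMap : (E →ₗ[ℝ] ℝ) ≃ₗ[ℝ] (E →L[ℝ] ℝ)).toLinearMap ∘ₗ B)
      = c • LinearMap.id := by
    ext X
    have h1 : LinearMap.toContinuousLinearMap (B X) = c • g X := by
      ext Y
      simpa using h X Y
    simp [h1, hg.inverse_apply_self]
  rw [metricTrace, this, map_smul, LinearMap.trace_id, smul_eq_mul]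

/-- The endomorphism `V ↦ R(V,X)Y` is `κ` times `G(X,Y) id` minus a rank-one map of trace `G(X,Y)`.
-/
theorem ricciLocal_eq {G : E → E →L[ℝ] E →L[ℝ] ℝ} {u : E} {κ : ℝ}
    (h : ∀ X Y Z, curvatureLocal G u X Y Z = κ • (G u Y Z • X - G u X Z • Y)) (X Y : E) :
    ricciLocal G u X Y = (Module.finrank ℝ E - 1) * κ * G u X Y := by
  have : curvatureEndo G u X Y = κ • (G u X Y • LinearMap.id
      - LinearMap.toSpanSingleton ℝ E X ∘ₗ ((G u).flip Y : E →ₗ[ℝ] ℝ)) := by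
    ext V
    simp [curvatureEndo, h]
  rw [ricciLocal, LinearMap.mk₂_apply, this, map_smul, map_sub, map_smul, LinearMap.trace_id,
    LinearMap.trace_comp_comm']
  have h2 : ((G u).flip Y : E →ₗ[ℝ] ℝ) ∘ₗ LinearMap.toSpanSingleton ℝ E X
      = G u X Y • LinearMap.id := by
    ext
    simp
  rw [h2, map_smul, LinearMap.trace_id]
  simp
  ring

end Trace

/-! ### From manifolds to preferred charts -/

section Charts

variable {E : Type*} [NormedAddCommGroup E] [NormedSpace ℝ E]
  {H : Type*} [TopologicalSpace H] {I : ModelWithCorners ℝ E H} [I.Boundaryless]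
  {M : Type*} [TopologicalSpace M] [ChartedSpace H M] [IsManifold I ∞ M]

theorem extChartAt_target_mem_nhds_of_mem {p : M} {u : E} (hu : u ∈ (extChartAt I p).target) :
    (extChartAt I p).target ∈ 𝓝 u :=
  (isOpen_extChartAt_target p).mem_nhds hu

theorem mdifferentiableAt_extChartAt_symm {p : M} {u : E} (hu : u ∈ (extChartAt I p).target) :
    MDifferentiableAt 𝓘(ℝ, E) I (extChartAt I p).symm u := by
  have : IsManifold I 1 M := IsManifold.of_le (n := ∞) (by exact_mod_cast le_top)
  have h := mdifferentiableWithinAt_extChartAt_symm (I := I) hu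
  rwa [I.range_eq_univ, mdifferentiableWithinAt_univ] at h

theorem isInvertible_chartSymmDeriv {p : M} {u : E} (hu : u ∈ (extChartAt I p).target) :
    (chartSymmDeriv I p u).IsInvertible := by
  have : IsManifold I 1 M := IsManifold.of_le (n := ∞) (by exact_mod_cast le_top)
  have h := isInvertible_mfderivWithin_extChartAt_symm (I := I) hu
  rwa [I.range_eq_univ, mfderivWithin_univ] at h

/-- The tangent space at each point is read in that point's own chart, so this derivative is that of
a transition map. It is the identity at the centre of the chart, which makes coordinate tensors
there agree with the intrinsic ones. -/
theorem chartSymmDeriv_eq_fderiv {p : M} {u : E} (hu : u ∈ (extChartAt I p).target) :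
    chartSymmDeriv I p u
      = fderiv ℝ (extChartAt I ((extChartAt I p).symm u) ∘ (extChartAt I p).symm) u := by
  rw [chartSymmDeriv, (mdifferentiableAt_extChartAt_symm hu).mfderiv]
  simp only [writtenInExtChartAt, extChartAt_model_space_eq_id, PartialEquiv.refl_coe,
    PartialEquiv.refl_symm, modelWithCornersSelf_coe, Set.range_id, fderivWithin_univ,
    Function.comp_id, id_eq]

theorem chartSymmDeriv_self (p : M) :
    chartSymmDeriv I p (extChartAt I p p) = ContinuousLinearMap.id ℝ E := by
  rw [chartSymmDeriv_eq_fderiv (mem_extChartAt_target p), extChartAt_to_inv]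
  have : (extChartAt I p ∘ (extChartAt I p).symm) =ᶠ[𝓝 (extChartAt I p p)] id := by
    filter_upwards [extChartAt_target_mem_nhds p] with w hw
    exact (extChartAt I p).right_inv hw
  rw [this.fderiv_eq, fderiv_id]

theorem localMetric_self (g : ∀ p : M, TangentSpace I p →L[ℝ] TangentSpace I p →L[ℝ] ℝ) (p : M) :
    localMetric I g p (extChartAt I p p) = formAt I g p := by
  rw [localMetric, chartSymmDeriv_self, extChartAt_to_inv]
  ext X Y
  simp

/-- Coordinate vector fields are smooth sections of the tangent bundle. Evaluating `g` on them gives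
smooth metric coefficients on the whole chart domain. -/
theorem contMDiffAt_chartSymmDeriv_apply {p : M} {u : E} (hu : u ∈ (extChartAt I p).target)
    (X : E) : ContMDiffAt 𝓘(ℝ, E) I.tangent ∞
      (fun w => (Bundle.TotalSpace.mk' E (E := TangentSpace I) ((extChartAt I p).symm w)
        (chartSymmDeriv I p w X))) u := by
  have : IsManifold I 1 M := IsManifold.of_le (n := ∞) (by exact_mod_cast le_top)
  have h1 := (contMDiffOn_extChartAt_symm (I := I) (n := ∞) p).contMDiffOn_tangentMapWithin
    (m := ∞) (by simp) (isOpen_extChartAt_target p).uniqueMDiffOn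
  have h2 : ContMDiff 𝓘(ℝ, E) 𝓘(ℝ, E).tangent ∞
      (fun w => (Bundle.TotalSpace.mk' E (E := TangentSpace 𝓘(ℝ, E)) w X)) :=
    contMDiff_vectorSpace_iff_contDiff.2 contDiff_const
  have hmem : (extChartAt I p).target ∈ 𝓝 u := extChartAt_target_mem_nhds_of_mem hu
  have h3 := (h1.contMDiffAt (x := Bundle.TotalSpace.mk' E (E := TangentSpace 𝓘(ℝ, E)) u X)
    (FiberBundle.continuous_proj E (TangentSpace 𝓘(ℝ, E)) |>.continuousAt.preimage_mem_nhds hmem)).comp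
      u h2.contMDiffAt
  refine h3.congr_of_eventuallyEq ?_
  filter_upwards [hmem] with w hw
  simp only [Function.comp_apply, tangentMapWithin, chartSymmDeriv]
  rw [mfderivWithin_of_mem_nhds (extChartAt_target_mem_nhds_of_mem hw)]
  rfl

variable [FiniteDimensional ℝ E]
  {g : ∀ p : M, TangentSpace I p →L[ℝ] TangentSpace I p →L[ℝ] ℝ}

theorem IsSemiRiemannian.contDiffOn_localMetric (hg : IsSemiRiemannian I g) (p : M) :
    ContDiffOn ℝ ∞ (localMetric I g p) (extChartAt I p).target := by
  rw [contDiffOn_clm_apply]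
  intro X
  rw [contDiffOn_clm_apply]
  intro Y u hu
  have hs : ContMDiffAt 𝓘(ℝ, E) I ∞ (extChartAt I p).symm u :=
    (contMDiffOn_extChartAt_symm p).contMDiffAt (extChartAt_target_mem_nhds_of_mem hu)
  have : ContMDiffAt 𝓘(ℝ, E) (I.prod 𝓘(ℝ)) ∞
      (fun w => Bundle.TotalSpace.mk' ℝ (E := Bundle.Trivial M ℝ) ((extChartAt I p).symm w)
        (g ((extChartAt I p).symm w) (chartSymmDeriv I p w X) (chartSymmDeriv I p w Y))) u := by
    apply ContMDiffAt.clm_bundle_apply₂ (F₁ := E) (F₂ := E)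
    · exact hg.smooth.contMDiffAt.comp u hs
    · exact contMDiffAt_chartSymmDeriv_apply hu X
    · exact contMDiffAt_chartSymmDeriv_apply hu Y
  simp only [Bundle.contMDiffAt_totalSpace] at this
  exact this.2.contDiffAt.contDiffWithinAt

theorem IsSemiRiemannian.isInvertible_formAt (hg : IsSemiRiemannian I g) (p : M) :
    (formAt I g p).IsInvertible :=
  isInvertible_of_nondegenerate _ (hg.nondegenerate p)

theorem IsSemiRiemannian.isInvertible_localMetric (hg : IsSemiRiemannian I g) {p : M} {u : E}
    (hu : u ∈ (extChartAt I p).target) : (localMetric I g p u).IsInvertible := by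
  refine isInvertible_of_nondegenerate _ fun X hX => ?_
  have hi := isInvertible_chartSymmDeriv hu
  have h0 : chartSymmDeriv I p u X = 0 := by
    refine IsInvertible.eq_zero (hg.isInvertible_formAt ((extChartAt I p).symm u)) fun Y => ?_
    obtain ⟨Z, rfl⟩ := hi.surjective Y
    exact hX Z
  exact hi.injective (h0.trans (map_zero _).symm)

theorem IsSemiRiemannian.localMetric_symm (hg : IsSemiRiemannian I g) (p : M) (u X Y : E) :
    localMetric I g p u X Y = localMetric I g p u Y X :=
  hg.symm ((extChartAt I p).symm u) (chartSymmDeriv I p u X) (chartSymmDeriv I p u Y)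

theorem IsSemiRiemannian.isLocalMetricAt (hg : IsSemiRiemannian I g) {p : M} {u : E}
    (hu : u ∈ (extChartAt I p).target) : IsLocalMetricAt (localMetric I g p) u where
  contDiffAt := (hg.contDiffOn_localMetric p).contDiffAt (extChartAt_target_mem_nhds_of_mem hu)
  symm := Eventually.of_forall fun w X Y => hg.localMetric_symm p w X Y
  isInvertible := by
    filter_upwards [extChartAt_target_mem_nhds_of_mem hu] with w hw
    exact hg.isInvertible_localMetric hw

theorem IsSemiRiemannian.eventually_isLocalMetricAt (hg : IsSemiRiemannian I g) (p : M) :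
    ∀ᶠ w in 𝓝 (extChartAt I p p), IsLocalMetricAt (localMetric I g p) w := by
  filter_upwards [extChartAt_target_mem_nhds p] with w hw using hg.isLocalMetricAt hw

theorem contDiffAt_comp_extChartAt_symm {φ : M → ℝ} (hφ : ContMDiff I 𝓘(ℝ, ℝ) ∞ φ) {p : M} {u : E}
    (hu : u ∈ (extChartAt I p).target) : ContDiffAt ℝ ∞ (φ ∘ (extChartAt I p).symm) u := by
  have hs : ContMDiffAt 𝓘(ℝ, E) I ∞ (extChartAt I p).symm u :=
    (contMDiffOn_extChartAt_symm p).contMDiffAt (extChartAt_target_mem_nhds_of_mem hu)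
  exact (hφ.contMDiffAt.comp u hs).contDiffAt

theorem eventually_contDiffAt_comp_extChartAt_symm {φ : M → ℝ} (hφ : ContMDiff I 𝓘(ℝ, ℝ) ∞ φ)
    (p : M) : ∀ᶠ w in 𝓝 (extChartAt I p p), ContDiffAt ℝ ∞ (φ ∘ (extChartAt I p).symm) w := by
  filter_upwards [extChartAt_target_mem_nhds p] with w hw
  exact contDiffAt_comp_extChartAt_symm hφ hw

theorem differential_eq_fderiv {φ : M → ℝ} (hφ : ContMDiff I 𝓘(ℝ, ℝ) ∞ φ) (p : M) :
    differential I φ p = fderiv ℝ (φ ∘ (extChartAt I p).symm) (extChartAt I p p) := by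
  rw [differential, ((hφ p).mdifferentiableAt (by simp)).mfderiv, I.range_eq_univ,
    fderivWithin_univ]
  rfl

theorem gradient_eq_gradientLocal {φ : M → ℝ} (hφ : ContMDiff I 𝓘(ℝ, ℝ) ∞ φ) (p : M) :
    gradient I g φ p
      = gradientLocal (localMetric I g p) (φ ∘ (extChartAt I p).symm) (extChartAt I p p) := by
  rw [gradient, gradientLocal, localMetric_self, differential_eq_fderiv hφ]

theorem IsSemiRiemannian.gradInner_eq (hg : IsSemiRiemannian I g) {φ ψ : M → ℝ}
    (hφ : ContMDiff I 𝓘(ℝ, ℝ) ∞ φ) (hψ : ContMDiff I 𝓘(ℝ, ℝ) ∞ ψ) (p : M) :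
    gradInner I g φ ψ p = fderiv ℝ (φ ∘ (extChartAt I p).symm) (extChartAt I p p)
      (gradientLocal (localMetric I g p) (ψ ∘ (extChartAt I p).symm) (extChartAt I p p)) := by
  rw [← gradient_eq_gradientLocal hψ, ← differential_eq_fderiv hφ]
  exact congrArg (fun L : E →L[ℝ] ℝ => L (gradient I g ψ p))
    ((hg.isInvertible_formAt p).self_apply_inverse (differential I φ p))

end Charts

/-! ### Behaviour under a change of coordinates -/

section Pullback

variable {E : Type*} [NormedAddCommGroup E] [NormedSpace ℝ E]
  {G G' : E → E →L[ℝ] E →L[ℝ] ℝ} {T : E → E} {u : E}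

/-- Transformation law of the Christoffel symbols under a change of coordinates. -/
theorem fderiv_christoffel_pullback (hG : IsLocalMetricAt G (T u)) (hT : ContDiffAt ℝ ∞ T u)
    (hT' : Function.Surjective (fderiv ℝ T u)) (hG' : IsLocalMetricAt G' u)
    (h : G' =ᶠ[𝓝 u] fun w => (G (T w)).bilinearComp (fderiv ℝ T w) (fderiv ℝ T w)) (X Y : E) :
    fderiv ℝ T u (christoffel G' u X Y) = fderiv ℝ (fderiv ℝ T) u X Y
      + christoffel G (T u) (fderiv ℝ T u X) (fderiv ℝ T u Y) := by
  have hdT := hT.differentiableAt (by simp)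
  have hddT : DifferentiableAt ℝ (fderiv ℝ T) u :=
    (hT.fderiv_right (m := ∞) (by simp)).differentiableAt (by simp)
  have hdG := hG.contDiffAt.differentiableAt (by simp)
  have hGT : HasFDerivAt (fun w => G (T w)) _ u := hdG.hasFDerivAt.comp u hdT.hasFDerivAt
  have hsymm : ∀ A B, fderiv ℝ (fderiv ℝ T) u A B = fderiv ℝ (fderiv ℝ T) u B A := fun A B =>
    (hT.isSymmSndFDerivAt (by
      rw [minSmoothness_of_isRCLikeNormedField]; exact WithTop.coe_le_coe.2 le_top)).eq A B
  have hs := hG.symm.self_of_nhds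
  have key : ∀ A B C, fderiv ℝ G' u A B C
      = fderiv ℝ G (T u) (fderiv ℝ T u A) (fderiv ℝ T u B) (fderiv ℝ T u C)
        + G (T u) (fderiv ℝ (fderiv ℝ T) u A B) (fderiv ℝ T u C)
        + G (T u) (fderiv ℝ T u B) (fderiv ℝ (fderiv ℝ T) u A C) := fun A B C => by
    rw [fderiv_form_apply (hG'.contDiffAt.differentiableAt (by simp))]
    have e : (fun w => G' w B C) =ᶠ[𝓝 u]
        fun w => G (T w) (fderiv ℝ T w B) (fderiv ℝ T w C) := by
      filter_upwards [h] with w hw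
      rw [hw]
      rfl
    have hB := hddT.hasFDerivAt.clm_apply (hasFDerivAt_const B u)
    have hC := hddT.hasFDerivAt.clm_apply (hasFDerivAt_const C u)
    rw [e.fderiv_eq, ((hGT.clm_apply hB).clm_apply hC).fderiv]
    simp
    ring
  -- Compare both sides by pairing with vectors `dT(Z)`, which exhaust the space. In the Koszul
  -- formula for `G'` four of the six terms in the second derivative of `T` cancel by symmetry; the
  -- other two combine into `G(D²T(X,Y), dT(Z))`.
  refine hG.isInvertible.self_of_nhds.injective ?_
  ext W
  obtain ⟨Z, rfl⟩ := hT' W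
  have h1 : G (T u) (fderiv ℝ T u (christoffel G' u X Y)) (fderiv ℝ T u Z)
      = G' u (christoffel G' u X Y) Z := by
    rw [h.eq_of_nhds]
    rfl
  rw [h1, metric_christoffel hG'.isInvertible.self_of_nhds, key, key, key, map_add,
    add_apply, metric_christoffel hG.isInvertible.self_of_nhds, hsymm Y X, hsymm Z X, hsymm Z Y,
    hs (fderiv ℝ (fderiv ℝ T) u X Z)]
  ring

/-- The second derivative of `T` enters once from the chain rule and once from the Christoffel
symbols, with opposite signs. -/
theorem hessianLocal_pullback (hG : IsLocalMetricAt G (T u)) (hT : ContDiffAt ℝ ∞ T u)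
    (hT' : Function.Surjective (fderiv ℝ T u)) (hG' : IsLocalMetricAt G' u)
    (h : G' =ᶠ[𝓝 u] fun w => (G (T w)).bilinearComp (fderiv ℝ T w) (fderiv ℝ T w))
    {φ φ' : E → ℝ} (hφ : ContDiffAt ℝ ∞ φ (T u)) (hφ' : φ' =ᶠ[𝓝 u] φ ∘ T) (X Y : E) :
    hessianLocal G' φ' u X Y = hessianLocal G φ (T u) (fderiv ℝ T u X) (fderiv ℝ T u Y) := by
  have hdT := hT.differentiableAt (by simp)
  have hddT : DifferentiableAt ℝ (fderiv ℝ T) u :=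
    (hT.fderiv_right (m := ∞) (by simp)).differentiableAt (by simp)
  have hdφ := hφ.differentiableAt (by simp)
  have hddφ : DifferentiableAt ℝ (fderiv ℝ φ) (T u) :=
    (hφ.fderiv_right (m := ∞) (by simp)).differentiableAt (by simp)
  have hD : fderiv ℝ φ' =ᶠ[𝓝 u] fun w => (fderiv ℝ φ (T w)).comp (fderiv ℝ T w) := by
    filter_upwards [hφ'.fderiv (𝕜 := ℝ), eventually_differentiableAt_of_contDiffAt hT,
      hT.continuousAt.eventually (eventually_differentiableAt_of_contDiffAt hφ)] with w h1 h2 h3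
    rw [h1, fderiv_comp w h3 h2]
  have hφT : HasFDerivAt (fun w => fderiv ℝ φ (T w)) _ u :=
    hddφ.hasFDerivAt.comp u hdT.hasFDerivAt
  rw [hessianLocal_apply, hessianLocal_apply, hD.fderiv_eq, hD.eq_of_nhds,
    (hφT.clm_comp hddT.hasFDerivAt).fderiv]
  simp [fderiv_christoffel_pullback hG hT hT' hG' h]

end Pullback

/-! ### Chart independence of the Hessian and smoothness of its factor -/

section ChartChange

variable {E : Type*} [NormedAddCommGroup E] [NormedSpace ℝ E] [FiniteDimensional ℝ E]
  {H : Type*} [TopologicalSpace H] {I : ModelWithCorners ℝ E H} [I.Boundaryless]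
  {M : Type*} [TopologicalSpace M] [ChartedSpace H M] [IsManifold I ∞ M]
  {g : ∀ p : M, TangentSpace I p →L[ℝ] TangentSpace I p →L[ℝ] ℝ}

theorem chartSymmDeriv_chartChange {p q : M} {u : E} (hu : u ∈ (extChartAt I p).target)
    (hq : (extChartAt I p).symm u ∈ (extChartAt I q).source) :
    chartSymmDeriv I p u = (chartSymmDeriv I q (extChartAt I q ((extChartAt I p).symm u))).comp
      (fderiv ℝ (extChartAt I q ∘ (extChartAt I p).symm) u) := by
  have : IsManifold I 1 M := IsManifold.of_le (n := ∞) (by exact_mod_cast le_top)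
  have hp := mdifferentiableAt_extChartAt_symm (I := I) hu
  have hq' : (extChartAt I p).symm u ∈ (chartAt H q).source := by
    rwa [← extChartAt_source (I := I)]
  have hT : MDifferentiableAt 𝓘(ℝ, E) 𝓘(ℝ, E) (extChartAt I q ∘ (extChartAt I p).symm) u :=
    (mdifferentiableAt_extChartAt hq').comp u hp
  have hqs := mdifferentiableAt_extChartAt_symm (I := I) ((extChartAt I q).map_source hq)
  have hc := mfderiv_comp (I' := 𝓘(ℝ, E)) (f := extChartAt I q ∘ (extChartAt I p).symm) u hqs hT
  have he : (extChartAt I p).symm =ᶠ[𝓝 u]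
      (extChartAt I q).symm ∘ (extChartAt I q ∘ (extChartAt I p).symm) := by
    filter_upwards [hp.continuousAt.preimage_mem_nhds
      ((isOpen_extChartAt_source q).mem_nhds hq)] with w hw
    exact ((extChartAt I q).left_inv hw).symm
  rw [chartSymmDeriv, he.mfderiv_eq]
  refine hc.trans ?_
  rw [mfderiv_eq_fderiv]
  rfl

theorem localMetric_chartChange {p q : M} {u : E} (hu : u ∈ (extChartAt I p).target)
    (hq : (extChartAt I p).symm u ∈ (extChartAt I q).source) :
    localMetric I g p u = (localMetric I g q (extChartAt I q ((extChartAt I p).symm u))).bilinearComp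
      (fderiv ℝ (extChartAt I q ∘ (extChartAt I p).symm) u)
      (fderiv ℝ (extChartAt I q ∘ (extChartAt I p).symm) u) := by
  rw [localMetric, chartSymmDeriv_chartChange hu hq, localMetric, (extChartAt I q).left_inv hq]
  rfl

/-- The Hessian of a function, computed in the preferred chart of another point. -/
theorem IsSemiRiemannian.hessianLocal_localMetric (hg : IsSemiRiemannian I g) {φ : M → ℝ}
    (hφ : ContMDiff I 𝓘(ℝ, ℝ) ∞ φ) {p : M} {u : E} (hu : u ∈ (extChartAt I p).target) (X Y : E) :
    hessianLocal (localMetric I g p) (φ ∘ (extChartAt I p).symm) u X Y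
      = hessian I g φ ((extChartAt I p).symm u) (chartSymmDeriv I p u X)
          (chartSymmDeriv I p u Y) := by
  set q := (extChartAt I p).symm u with hq
  set T := extChartAt I q ∘ (extChartAt I p).symm with hTdef
  have hsymm : ContMDiffAt 𝓘(ℝ, E) I ∞ (extChartAt I p).symm u :=
    (contMDiffOn_extChartAt_symm p).contMDiffAt (extChartAt_target_mem_nhds_of_mem hu)
  have hT : ContDiffAt ℝ ∞ T u :=
    ((contMDiffAt_extChartAt (I := I) (x := q)).comp u hsymm).contDiffAt
  have hmem : ∀ᶠ w in 𝓝 u, (extChartAt I p).symm w ∈ (extChartAt I q).source :=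
    hsymm.continuousAt.preimage_mem_nhds (extChartAt_source_mem_nhds q)
  have hD : chartSymmDeriv I p u = fderiv ℝ T u := chartSymmDeriv_eq_fderiv hu
  have hTu : T u = extChartAt I q q := rfl
  rw [hD]
  refine hessianLocal_pullback (T := T) (hg.isLocalMetricAt (mem_extChartAt_target q)) hT ?_
    (hg.isLocalMetricAt hu) ?_
    (contDiffAt_comp_extChartAt_symm hφ (mem_extChartAt_target q)) ?_ X Y
  · rw [← hD]
    exact (isInvertible_chartSymmDeriv hu).surjective
  · filter_upwards [hmem, extChartAt_target_mem_nhds_of_mem hu] with w h1 h2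
    exact localMetric_chartChange h2 h1
  · filter_upwards [hmem] with w h1
    simp only [Function.comp_apply, hTdef]
    rw [(extChartAt I q).left_inv h1]

/-- If `H^φ = l g` then `l` is smooth. -/
theorem IsSemiRiemannian.contMDiff_of_hessian_eq [Nontrivial E] (hg : IsSemiRiemannian I g)
    {φ l : M → ℝ} (hφ : ContMDiff I 𝓘(ℝ, ℝ) ∞ φ)
    (h : ∀ (p : M) (X Y : TangentSpace I p), hessian I g φ p X Y = l p * g p X Y) :
    ContMDiff I 𝓘(ℝ, ℝ) ∞ l := by
  intro p
  have hm := hg.isLocalMetricAt (mem_extChartAt_target (I := I) p)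
  obtain ⟨X, Y, hXY⟩ := hm.exists_apply_ne_zero
  set G := localMetric I g p
  set ψ := φ ∘ (extChartAt I p).symm
  have hψ : ContDiffAt ℝ ∞ ψ (extChartAt I p p) :=
    contDiffAt_comp_extChartAt_symm hφ (mem_extChartAt_target p)
  have hGXY : ContDiffAt ℝ ∞ (fun w => G w X Y) (extChartAt I p p) :=
    (hm.contDiffAt.clm_apply contDiffAt_const).clm_apply contDiffAt_const
  have hH : ContDiffAt ℝ ∞ (fun w => hessianLocal G ψ w X Y) (extChartAt I p p) := by
    have h1 : ContDiffAt ℝ ∞ (fderiv ℝ ψ) (extChartAt I p p) := hψ.fderiv_right (by simp)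
    have h2 : ContDiffAt ℝ ∞ (fderiv ℝ (fderiv ℝ ψ)) (extChartAt I p p) :=
      h1.fderiv_right (by simp)
    exact ((h2.clm_apply contDiffAt_const).clm_apply contDiffAt_const).sub
      (h1.clm_apply ((hm.contDiffAt_christoffel.clm_apply contDiffAt_const).clm_apply
        contDiffAt_const))
  -- In the single chart at `p`, for fixed vectors with `G(X,Y) ≠ 0` at the centre, the quotient of
  -- Hessian by metric is smooth. By chart independence it equals `l` at all nearby points, not only
  -- at `p`.
  have hl : ContMDiffAt I 𝓘(ℝ, ℝ) ∞
      ((fun w => hessianLocal G ψ w X Y / G w X Y) ∘ extChartAt I p) p :=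
    (hH.div hGXY hXY).contMDiffAt.comp p contMDiffAt_extChartAt
  refine hl.congr_of_eventuallyEq ?_
  have hne : ∀ᶠ r in 𝓝 p, G (extChartAt I p r) X Y ≠ 0 :=
    (continuousAt_extChartAt p).eventually (hGXY.continuousAt.eventually_ne hXY)
  filter_upwards [hne, extChartAt_source_mem_nhds (I := I) p] with r hr hs
  have e := hg.hessianLocal_localMetric hφ ((extChartAt I p).map_source hs) X Y
  have e' : hessianLocal G ψ (extChartAt I p r) X Y
      = l ((extChartAt I p).symm (extChartAt I p r)) * G (extChartAt I p r) X Y :=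
    e.trans (h _ _ _)
  rw [(extChartAt I p).left_inv hs] at e'
  rw [Function.comp_apply, eq_div_iff hr, e']

end ChartChange

/-! ### Warped metrics in product charts -/

section WarpedChart

variable {E : Type*} [NormedAddCommGroup E] [NormedSpace ℝ E]
  {H : Type*} [TopologicalSpace H] {I : ModelWithCorners ℝ E H} [I.Boundaryless]
  {B : Type*} [TopologicalSpace B] [ChartedSpace H B] [IsManifold I ∞ B]
  {E' : Type*} [NormedAddCommGroup E'] [NormedSpace ℝ E']
  {H' : Type*} [TopologicalSpace H'] {I' : ModelWithCorners ℝ E' H'} [I'.Boundaryless]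
  {F : Type*} [TopologicalSpace F] [ChartedSpace H' F] [IsManifold I' ∞ F]

theorem differentiableAt_chartChange {p : B} {u : E} (hu : u ∈ (extChartAt I p).target) :
    DifferentiableAt ℝ (extChartAt I ((extChartAt I p).symm u) ∘ (extChartAt I p).symm) u := by
  have hsymm : ContMDiffAt 𝓘(ℝ, E) I ∞ (extChartAt I p).symm u :=
    (contMDiffOn_extChartAt_symm p).contMDiffAt (extChartAt_target_mem_nhds_of_mem hu)
  exact ((contMDiffAt_extChartAt (I := I)).comp u hsymm).contDiffAt.differentiableAt (by simp)

theorem chartSymmDeriv_prod (p : B × F) {w : E × E'} (h₁ : w.1 ∈ (extChartAt I p.1).target)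
    (h₂ : w.2 ∈ (extChartAt I' p.2).target) :
    chartSymmDeriv (I.prod I') p w
      = (chartSymmDeriv I p.1 w.1).prodMap (chartSymmDeriv I' p.2 w.2) := by
  have hw : w ∈ (extChartAt (I.prod I') p).target := by
    rw [extChartAt_prod]
    exact ⟨h₁, h₂⟩
  rw [chartSymmDeriv_eq_fderiv hw, chartSymmDeriv_eq_fderiv h₁, chartSymmDeriv_eq_fderiv h₂]
  have h := (differentiableAt_chartChange h₁).hasFDerivAt.prodMap w
    (differentiableAt_chartChange h₂).hasFDerivAt
  rw [← h.fderiv]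
  simp only [extChartAt_prod]
  rfl

theorem localMetric_warpedMetric (gB : ∀ p : B, TangentSpace I p →L[ℝ] TangentSpace I p →L[ℝ] ℝ)
    (gF : ∀ p : F, TangentSpace I' p →L[ℝ] TangentSpace I' p →L[ℝ] ℝ) (f : B → ℝ) (p : B × F)
    {w : E × E'} (h₁ : w.1 ∈ (extChartAt I p.1).target)
    (h₂ : w.2 ∈ (extChartAt I' p.2).target) :
    localMetric (I.prod I') (warpedMetric I I' gB gF f) p w
      = warpedLocal (localMetric I gB p.1) (localMetric I' gF p.2)
          (f ∘ (extChartAt I p.1).symm) w := by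
  rw [localMetric, chartSymmDeriv_prod p h₁ h₂, extChartAt_prod]
  rfl

theorem eventuallyEq_localMetric_warpedMetric
    (gB : ∀ p : B, TangentSpace I p →L[ℝ] TangentSpace I p →L[ℝ] ℝ)
    (gF : ∀ p : F, TangentSpace I' p →L[ℝ] TangentSpace I' p →L[ℝ] ℝ) (f : B → ℝ) (p : B × F) :
    localMetric (I.prod I') (warpedMetric I I' gB gF f) p
      =ᶠ[𝓝 (extChartAt I p.1 p.1, extChartAt I' p.2 p.2)]
        warpedLocal (localMetric I gB p.1) (localMetric I' gF p.2)
          (f ∘ (extChartAt I p.1).symm) := by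
  filter_upwards [prod_mem_nhds (extChartAt_target_mem_nhds p.1)
    (extChartAt_target_mem_nhds p.2)] with w hw
  exact localMetric_warpedMetric gB gF f p hw.1 hw.2

end WarpedChart

/-! ### Rigidity of sequential warped products in coordinates -/

section SequentialLocal

variable {E₁ : Type*} [NormedAddCommGroup E₁] [NormedSpace ℝ E₁] [FiniteDimensional ℝ E₁]
  {E₂ : Type*} [NormedAddCommGroup E₂] [NormedSpace ℝ E₂] [FiniteDimensional ℝ E₂]
  {E₃ : Type*} [NormedAddCommGroup E₃] [NormedSpace ℝ E₃] [FiniteDimensional ℝ E₃]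
  {G₁ : E₁ → E₁ →L[ℝ] E₁ →L[ℝ] ℝ} {G₂ : E₂ → E₂ →L[ℝ] E₂ →L[ℝ] ℝ}
  {G₃ : E₃ → E₃ →L[ℝ] E₃ →L[ℝ] ℝ} {f : E₁ → ℝ} {h : E₁ × E₂ → ℝ} {u : E₁} {v : E₂} {w : E₃}

/-- The one-step rigidity is used twice: the outer warping gives the base `M₁ ×_f M₂`
constant-curvature form, which is exactly the hypothesis of the inner application. Restricting the
Hessian of `h` to base and fibre directions of `M₁ ×_f M₂` yields its two partial Hessians. -/
theorem exists_of_curvatureLocal_sequential [Nontrivial E₁] [Nontrivial E₂] [Nontrivial E₃]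
    (h₁ : ∀ᶠ a in 𝓝 u, IsLocalMetricAt G₁ a) (h₂ : ∀ᶠ a in 𝓝 v, IsLocalMetricAt G₂ a)
    (h₃ : ∀ᶠ a in 𝓝 w, IsLocalMetricAt G₃ a)
    (hf : ∀ᶠ a in 𝓝 u, ContDiffAt ℝ ∞ f a) (hf0 : f u ≠ 0)
    (hh : ∀ᶠ a in 𝓝 (u, v), ContDiffAt ℝ ∞ h a) (hh0 : h (u, v) ≠ 0)
    (θ : LinearMap.BilinForm ℝ ((E₁ × E₂) × E₃))
    (hθ : ∀ A B C, curvatureLocal (warpedLocal (warpedLocal G₁ G₂ f) G₃ h) ((u, v), w) A B C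
      = θ B C • A - θ A C • B) :
    ∃ κ : ℝ, (∀ A B, θ A B = κ * warpedLocal (warpedLocal G₁ G₂ f) G₃ h ((u, v), w) A B) ∧
      (∀ X Y, hessianLocal G₁ f u X Y = -(κ * f u) * G₁ u X Y) ∧
      (∀ X Y, hessianLocal G₁ (fun a => h (a, v)) u X Y = -(κ * h (u, v)) * G₁ u X Y) ∧
      (∀ X Y Z, curvatureLocal G₁ u X Y Z = κ • (G₁ u Y Z • X - G₁ u X Z • Y)) ∧
      (∀ X Y Z, curvatureLocal G₂ v X Y Z
        = (κ * f u ^ 2 + fderiv ℝ f u (gradientLocal G₁ f u)) •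
            (G₂ v Y Z • X - G₂ v X Z • Y)) ∧
      (∀ X Y, hessianLocal G₂ (fun b => h (u, b)) v X Y
        = -(κ * h (u, v) * f u ^ 2
            + f u * fderiv ℝ (fun a => h (a, v)) u (gradientLocal G₁ f u)) * G₂ v X Y) ∧
      (∀ X Y Z, curvatureLocal G₃ w X Y Z
        = (κ * h (u, v) ^ 2
            + fderiv ℝ h (u, v) (gradientLocal (warpedLocal G₁ G₂ f) h (u, v))) •
            (G₃ w Y Z • X - G₃ w X Z • Y)) := by
  have hf0' : ∀ᶠ a in 𝓝 u, f a ≠ 0 := hf.self_of_nhds.continuousAt.eventually_ne hf0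
  have h₁₂ : ∀ᶠ a in 𝓝 (u, v), IsLocalMetricAt (warpedLocal G₁ G₂ f) a := by
    filter_upwards [(h₁.and (hf.and hf0')).prod_nhds h₂] with a ha
    exact ha.1.1.warped ha.2 ha.1.2.1 ha.1.2.2
  obtain ⟨κ, hκ, hH, hR, hR₃⟩ :=
    exists_of_curvatureLocal_warpedLocal (q := ((u, v), w)) h₁₂ h₃ hh hh0 θ hθ
  let θ' : LinearMap.BilinForm ℝ (E₁ × E₂) := θ.compl₁₂ (LinearMap.inl ℝ (E₁ × E₂) E₃)
    (LinearMap.inl ℝ (E₁ × E₂) E₃)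
  have hθ' : ∀ A B, θ' A B = κ * warpedLocal G₁ G₂ f (u, v) A B := fun A B => by
    simp [θ', hκ, warpedLocal_apply (warpedLocal G₁ G₂ f)]
  obtain ⟨κ', hκ', hH', hR', hR₂⟩ :=
    exists_of_curvatureLocal_warpedLocal (q := (u, v)) h₁ h₂ hf hf0 θ' fun A B C => by
      rw [hR, hθ', hθ', smul_sub, smul_smul, smul_smul]
  -- Both constants multiply the same nonzero metric to give `θ'`.
  have hκκ : κ' = κ := by
    obtain ⟨A, B, hAB⟩ := h₁₂.self_of_nhds.exists_apply_ne_zero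
    exact mul_right_cancel₀ hAB ((hκ' A B).symm.trans (hθ' A B))
  subst hκκ
  refine ⟨κ', hκ, hH', fun X Y => ?_, hR', hR₂, fun X Y => ?_, hR₃⟩
  · have e := hH (X, 0) (Y, 0)
    rw [hessianLocal_warpedLocal_base (q := (u, v)) h₁.self_of_nhds h₂.self_of_nhds
      hf.self_of_nhds hf0 hh.self_of_nhds] at e
    simpa [warpedLocal_apply] using e
  · have e := hH (0, X) (0, Y)
    rw [hessianLocal_warpedLocal_fiber (q := (u, v)) h₁.self_of_nhds h₂.self_of_nhds
      hf.self_of_nhds hf0 hh.self_of_nhds] at e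
    simp [warpedLocal_apply] at e
    linarith

end SequentialLocal

/-! ### Solving `P = 0` for the curvature -/

section LinearAlgebra

theorem eq_of_smul_add_smul_sub_smul_eq_zero {V : Type*} [AddCommGroup V] [Module ℝ V]
    {α β c r s a b : ℝ} {R A B : V} (hα : α ≠ 0)
    (e : α • R + β • (r • A - s • B) - c • (a • A - b • B) = 0) :
    R = (α⁻¹ * (c * a - β * r)) • A - (α⁻¹ * (c * b - β * s)) • B := by
  have e' : α • R = c • (a • A - b • B) - β • (r • A - s • B) := by
    rw [eq_sub_iff_add_eq, ← sub_eq_zero]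
    exact e
  rw [← inv_smul_smul₀ hα R, e']
  module

end LinearAlgebra

/-! ### Space-form equations on the factors -/

section Sequential

variable {E₁ : Type*} [NormedAddCommGroup E₁] [NormedSpace ℝ E₁] [FiniteDimensional ℝ E₁]
  {H₁ : Type*} [TopologicalSpace H₁] {I₁ : ModelWithCorners ℝ E₁ H₁} [I₁.Boundaryless]
  {M₁ : Type*} [TopologicalSpace M₁] [ChartedSpace H₁ M₁] [IsManifold I₁ ∞ M₁]
  {E₂ : Type*} [NormedAddCommGroup E₂] [NormedSpace ℝ E₂] [FiniteDimensional ℝ E₂]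
  {H₂ : Type*} [TopologicalSpace H₂] {I₂ : ModelWithCorners ℝ E₂ H₂} [I₂.Boundaryless]
  {M₂ : Type*} [TopologicalSpace M₂] [ChartedSpace H₂ M₂] [IsManifold I₂ ∞ M₂]
  {E₃ : Type*} [NormedAddCommGroup E₃] [NormedSpace ℝ E₃] [FiniteDimensional ℝ E₃]
  {H₃ : Type*} [TopologicalSpace H₃] {I₃ : ModelWithCorners ℝ E₃ H₃} [I₃.Boundaryless]
  {M₃ : Type*} [TopologicalSpace M₃] [ChartedSpace H₃ M₃] [IsManifold I₃ ∞ M₃]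
  {g₁ : ∀ p : M₁, TangentSpace I₁ p →L[ℝ] TangentSpace I₁ p →L[ℝ] ℝ}
  {g₂ : ∀ p : M₂, TangentSpace I₂ p →L[ℝ] TangentSpace I₂ p →L[ℝ] ℝ}
  {g₃ : ∀ p : M₃, TangentSpace I₃ p →L[ℝ] TangentSpace I₃ p →L[ℝ] ℝ}
  {f : M₁ → ℝ} {h : M₁ × M₂ → ℝ} {α β : ℝ}

variable (I₁ I₂ I₃ g₁ g₂ g₃ f h) in
/-- The equations that a sequential warped product of sectional curvature `κ` at `((x, y), z)`
imposes on its factors; `k` is the squared norm of the gradient of `h` at `(x, y)`. -/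
structure SpaceFormEquations (κ k : ℝ) (x : M₁) (y : M₂) (z : M₃) : Prop where
  hessian_f : ∀ X Y, hessian I₁ g₁ f x X Y = -(κ * f x) * g₁ x X Y
  hessian_h₁ : ∀ X Y,
    hessian I₁ g₁ (fun x' => h (x', y)) x X Y = -(κ * h (x, y)) * g₁ x X Y
  hessian_h₂ : ∀ X Y, hessian I₂ g₂ (fun y' => h (x, y')) y X Y
    = -(κ * h (x, y) * f x ^ 2 + f x * gradInner I₁ g₁ (fun x' => h (x', y)) f x) * g₂ y X Y
  ricci₁ : ∀ X Y, ricci I₁ g₁ x X Y = (Module.finrank ℝ E₁ - 1) * κ * g₁ x X Y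
  ricci₂ : ∀ X Y, ricci I₂ g₂ y X Y
    = (Module.finrank ℝ E₂ - 1) * (κ * f x ^ 2 + gradInner I₁ g₁ f f x) * g₂ y X Y
  ricci₃ : ∀ X Y, ricci I₃ g₃ z X Y
    = (Module.finrank ℝ E₃ - 1) * (κ * h (x, y) ^ 2 + k) * g₃ z X Y

variable (I₁ I₂ g₁ g₂ f h) in
/-- The squared norm of the gradient of `h` in `M₁ ×_f M₂`, computed in coordinates. -/
noncomputable def sqNormGradient (x : M₁) (y : M₂) : ℝ :=
  let G := warpedLocal (localMetric I₁ g₁ x) (localMetric I₂ g₂ y) (f ∘ (extChartAt I₁ x).symm)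
  let φ := h ∘ (extChartAt (I₁.prod I₂) (x, y)).symm
  let u := (extChartAt I₁ x x, extChartAt I₂ y y)
  fderiv ℝ φ u (gradientLocal G φ u)

theorem eventuallyEq_localMetric_sequentialMetric (x : M₁) (y : M₂) (z : M₃) :
    localMetric ((I₁.prod I₂).prod I₃) (sequentialMetric I₁ I₂ I₃ g₁ g₂ g₃ f h) ((x, y), z)
      =ᶠ[𝓝 ((extChartAt I₁ x x, extChartAt I₂ y y), extChartAt I₃ z z)]
        warpedLocal (warpedLocal (localMetric I₁ g₁ x) (localMetric I₂ g₂ y)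
          (f ∘ (extChartAt I₁ x).symm)) (localMetric I₃ g₃ z)
          (h ∘ (extChartAt (I₁.prod I₂) (x, y)).symm) := by
  have e := eventuallyEq_localMetric_warpedMetric (warpedMetric I₁ I₂ g₁ g₂ f) g₃ h ((x, y), z)
  have hu : extChartAt (I₁.prod I₂) (x, y) (x, y) = (extChartAt I₁ x x, extChartAt I₂ y y) := by
    rw [extChartAt_prod]
    rfl
  simp only [hu] at e
  have e' : ∀ᶠ w in 𝓝 ((extChartAt I₁ x x, extChartAt I₂ y y), extChartAt I₃ z z),
      localMetric (I₁.prod I₂) (warpedMetric I₁ I₂ g₁ g₂ f) (x, y) (Prod.fst w)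
        = warpedLocal (localMetric I₁ g₁ x) (localMetric I₂ g₂ y) (f ∘ (extChartAt I₁ x).symm)
            (Prod.fst w) := by
    have e₁ := eventuallyEq_localMetric_warpedMetric g₁ g₂ f (x, y)
    exact (continuousAt_fst (p := ((extChartAt I₁ x x, extChartAt I₂ y y),
      extChartAt I₃ z z))).eventually e₁
  filter_upwards [e, e'] with w h₁ h₂
  refine h₁.trans ?_
  rw [warpedLocal, h₂]
  rfl

/-- Transfers the coordinate result to the manifolds. Pointwise constant curvature gives `τ̄ =
n(n-1)κ`, so `(τ̄/n)(α/(n-1)+β)` becomes `κ(α+(n-1)β)`. -/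
theorem exists_spaceFormEquations [Nontrivial E₁] [Nontrivial E₂] [Nontrivial E₃]
    (hg₁ : IsSemiRiemannian I₁ g₁) (hg₂ : IsSemiRiemannian I₂ g₂) (hg₃ : IsSemiRiemannian I₃ g₃)
    (hf : ContMDiff I₁ 𝓘(ℝ, ℝ) ∞ f) (hf0 : ∀ x, f x ≠ 0)
    (hh : ContMDiff (I₁.prod I₂) 𝓘(ℝ, ℝ) ∞ h) (hh0 : ∀ q, h q ≠ 0) (hα : α ≠ 0)
    (hflat : IsPseudoProjectivelyFlat ((I₁.prod I₂).prod I₃)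
      (sequentialMetric I₁ I₂ I₃ g₁ g₂ g₃ f h) α β) (x : M₁) (y : M₂) (z : M₃) :
    ∃ κ : ℝ, scalarFactor I₁ I₂ I₃ g₁ g₂ g₃ f h α β ((x, y), z)
        = κ * (α + (Module.finrank ℝ E₁ + Module.finrank ℝ E₂ + Module.finrank ℝ E₃ - 1) * β) ∧
      SpaceFormEquations I₁ I₂ I₃ g₁ g₂ g₃ f h κ (sqNormGradient I₁ I₂ g₁ g₂ f h x y) x y z := by
  set p : (M₁ × M₂) × M₃ := ((x, y), z) with hp
  set u := extChartAt I₁ x x with hu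
  set v := extChartAt I₂ y y with hv
  set w := extChartAt I₃ z z with hw
  set J := (I₁.prod I₂).prod I₃ with hJ
  set gg := sequentialMetric I₁ I₂ I₃ g₁ g₂ g₃ f h with hgg
  set G₁ := localMetric I₁ g₁ x with hG₁
  set G₂ := localMetric I₂ g₂ y with hG₂
  set G₃ := localMetric I₃ g₃ z with hG₃
  set f' := f ∘ (extChartAt I₁ x).symm with hf'
  set h' := h ∘ (extChartAt (I₁.prod I₂) (x, y)).symm with hh'
  have huvw : extChartAt J p p = ((u, v), w) := by
    simp only [hJ, hp, extChartAt_prod]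
    rfl
  have huv : extChartAt (I₁.prod I₂) (x, y) (x, y) = (u, v) := by
    rw [extChartAt_prod]
    rfl
  have hloc : localMetric J gg p =ᶠ[𝓝 ((u, v), w)] warpedLocal (warpedLocal G₁ G₂ f') G₃ h' :=
    eventuallyEq_localMetric_sequentialMetric x y z
  set c : ℝ := scalarCurvature J gg p / (Module.finrank ℝ ((E₁ × E₂) × E₃) : ℝ)
        * (α / ((Module.finrank ℝ ((E₁ × E₂) × E₃) : ℝ) - 1) + β)
  let gB : LinearMap.BilinForm ℝ ((E₁ × E₂) × E₃) :=
    LinearMap.mk₂ ℝ (fun X Y => formAt J gg p X Y) (by simp) (by simp) (by simp) (by simp)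
  -- The form obtained by solving `P = 0` for `R`, with `c` the scalar coefficient in `P`.
  let θ : LinearMap.BilinForm ℝ ((E₁ × E₂) × E₃) :=
    α⁻¹ • (c • gB - β • ricciLocal (localMetric J gg p) ((u, v), w))
  have hθ : ∀ A B C, curvatureLocal (localMetric J gg p) ((u, v), w) A B C
      = θ B C • A - θ A C • B := fun A B C => by
    have e : α • curvatureLocal (localMetric J gg p) (extChartAt J p p) A B C
      + β • (ricciLocal (localMetric J gg p) (extChartAt J p p) B C • A
        - ricciLocal (localMetric J gg p) (extChartAt J p p) A C • B)
      - c • (formAt J gg p B C • A - formAt J gg p A C • B) = 0 := hflat p A B C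
    rw [huvw] at e
    exact eq_of_smul_add_smul_sub_smul_eq_zero hα e
  have hf0' : f' u ≠ 0 := by simpa [hf', hu] using hf0 x
  have hfu : f' u = f x := by simp [hf', hu]
  have hhu : h' (u, v) = h (x, y) := by
    rw [← huv, hh', Function.comp_apply, extChartAt_to_inv]
  have hh₁ : (fun a => h' (a, v)) = (fun x' => h (x', y)) ∘ (extChartAt I₁ x).symm := by
    funext a
    simp only [hh', extChartAt_prod, Function.comp_apply]
    exact congrArg (fun b => h ((extChartAt I₁ x).symm a, b)) (extChartAt_to_inv (I := I₂) y)
  have hh₂ : (fun b => h' (u, b)) = (fun y' => h (x, y')) ∘ (extChartAt I₂ y).symm := by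
    funext b
    simp only [hh', extChartAt_prod, Function.comp_apply]
    exact congrArg (fun a => h (a, (extChartAt I₂ y).symm b)) (extChartAt_to_inv (I := I₁) x)
  have hsm₁ : ContMDiff I₁ 𝓘(ℝ, ℝ) ∞ (fun x' => h (x', y)) :=
    hh.comp (contMDiff_id.prodMk contMDiff_const)
  have hevh : ∀ᶠ a in 𝓝 (u, v), ContDiffAt ℝ ∞ h' a := by
    rw [← huv]
    exact eventually_contDiffAt_comp_extChartAt_symm hh (x, y)
  have hev₁ : ∀ᶠ a in 𝓝 u, IsLocalMetricAt G₁ a := hg₁.eventually_isLocalMetricAt x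
  have hev₂ : ∀ᶠ a in 𝓝 v, IsLocalMetricAt G₂ a := hg₂.eventually_isLocalMetricAt y
  have hev₃ : ∀ᶠ a in 𝓝 w, IsLocalMetricAt G₃ a := hg₃.eventually_isLocalMetricAt z
  have hevf : ∀ᶠ a in 𝓝 u, ContDiffAt ℝ ∞ f' a := eventually_contDiffAt_comp_extChartAt_symm hf x
  obtain ⟨κ, hκ, hHf, hHh₁, hR₁, hR₂, hHh₂, hR₃⟩ := exists_of_curvatureLocal_sequential
    hev₁ hev₂ hev₃ hevf hf0' hevh (by rw [hhu]; exact hh0 _) θ (fun A B C => by rw [← curvatureLocal_congr hloc, hθ])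
  have hinv : (localMetric J gg p ((u, v), w)).IsInvertible := by
    rw [hloc.eq_of_nhds]
    exact ((hev₁.self_of_nhds.warped (q := (u, v)) hev₂.self_of_nhds hevf.self_of_nhds
      hf0').warped (q := ((u, v), w)) hev₃.self_of_nhds hevh.self_of_nhds
      (by rw [hhu]; exact hh0 _)).isInvertible.self_of_nhds
  have hτ : scalarCurvature J gg p = (Module.finrank ℝ ((E₁ × E₂) × E₃) - 1) * κ
      * Module.finrank ℝ ((E₁ × E₂) × E₃) := by
    rw [scalarCurvature, huvw]
    refine metricTrace_eq hinv (ricciLocal_eq fun X Y Z => ?_)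
    rw [hθ, hκ, hκ, hloc.eq_of_nhds, smul_sub, smul_smul, smul_smul]
  have hsG₁ : G₁ u = formAt I₁ g₁ x := localMetric_self g₁ x
  have hsG₂ : G₂ v = formAt I₂ g₂ y := localMetric_self g₂ y
  have hsG₃ : G₃ w = formAt I₃ g₃ z := localMetric_self g₃ z
  refine ⟨κ, ?_, ?_⟩
  · have h₁ : (0 : ℝ) < Module.finrank ℝ E₁ := by exact_mod_cast Module.finrank_pos
    have h₂ : (1 : ℝ) ≤ Module.finrank ℝ E₂ := by exact_mod_cast Module.finrank_pos
    have h₃ : (0 : ℝ) < Module.finrank ℝ E₃ := by exact_mod_cast Module.finrank_pos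
    simp only [scalarFactor]
    rw [← hJ, ← hgg, hτ]
    simp only [Module.finrank_prod, Nat.cast_add]
    have hn : (Module.finrank ℝ E₁ + Module.finrank ℝ E₂ + Module.finrank ℝ E₃ : ℝ) ≠ 0 := by
      linarith
    have hn' : (Module.finrank ℝ E₁ + Module.finrank ℝ E₂ + Module.finrank ℝ E₃ - 1 : ℝ) ≠ 0 := by
      linarith
    field_simp
  · have hN₁ : gradInner I₁ g₁ f f x = fderiv ℝ f' u (gradientLocal G₁ f' u) :=
      hg₁.gradInner_eq hf hf x
    have hN₂ : gradInner I₁ g₁ (fun x' => h (x', y)) f x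
        = fderiv ℝ ((fun x' => h (x', y)) ∘ (extChartAt I₁ x).symm) u (gradientLocal G₁ f' u) :=
      hg₁.gradInner_eq hsm₁ hf x
    refine ⟨fun X Y => ?_, fun X Y => ?_, fun X Y => ?_, fun X Y => ?_, fun X Y => ?_,
      fun X Y => ?_⟩
    · have e := hHf X Y
      rw [hsG₁, hfu] at e
      exact e
    · have e := hHh₁ X Y
      rw [hsG₁, hhu, hh₁] at e
      exact e
    · have e := hHh₂ X Y
      rw [hsG₂, hhu, hh₁, hh₂, hfu, ← hN₂] at e
      exact e
    · have e := ricciLocal_eq hR₁ X Y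
      rw [hsG₁] at e
      exact e
    · have e := ricciLocal_eq hR₂ X Y
      rw [hsG₂, hfu, ← hN₁] at e
      exact e
    · have e := ricciLocal_eq hR₃ X Y
      rw [hsG₃, hhu] at e
      exact e

end Sequential

/-! ### Logarithmic potentials and Catino's equation -/

section LogPotential

variable {E : Type*} [NormedAddCommGroup E] [NormedSpace ℝ E]

theorem hessianLocal_const_mul_log (G : E → E →L[ℝ] E →L[ℝ] ℝ) {φ : E → ℝ} {u : E}
    (hφ : ContDiffAt ℝ ∞ φ u) (h0 : φ u ≠ 0) (c : ℝ) (X Y : E) :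
    hessianLocal G (fun w => c * Real.log (φ w)) u X Y
      = c * (hessianLocal G φ u X Y / φ u - fderiv ℝ φ u X * fderiv ℝ φ u Y / φ u ^ 2) := by
  have hd := hφ.differentiableAt (by simp)
  have hdd : DifferentiableAt ℝ (fderiv ℝ φ) u :=
    (hφ.fderiv_right (m := ∞) (by simp)).differentiableAt (by simp)
  have h1 : fderiv ℝ (fun w => c * Real.log (φ w)) =ᶠ[𝓝 u]
      fun w => c • ((φ w)⁻¹ • fderiv ℝ φ w) := by
    filter_upwards [eventually_differentiableAt_of_contDiffAt hφ,
      hφ.continuousAt.eventually_ne h0] with w hw hw0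
    exact ((hw.hasFDerivAt.log hw0).const_mul c).fderiv
  have hinv : HasFDerivAt (fun w => (φ w)⁻¹) _ u :=
    (hasDerivAt_inv h0).comp_hasFDerivAt u hd.hasFDerivAt
  rw [hessianLocal_apply, hessianLocal_apply, h1.fderiv_eq, h1.eq_of_nhds,
    ((hinv.fun_smul hdd.hasFDerivAt).fun_const_smul c).fderiv]
  simp
  field_simp
  ring

variable [FiniteDimensional ℝ E]
  {H : Type*} [TopologicalSpace H] {I : ModelWithCorners ℝ E H} [I.Boundaryless]
  {M : Type*} [TopologicalSpace M] [ChartedSpace H M] [IsManifold I ∞ M]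
  {g : ∀ p : M, TangentSpace I p →L[ℝ] TangentSpace I p →L[ℝ] ℝ}

theorem IsSemiRiemannian.laplacian_eq (hg : IsSemiRiemannian I g) {φ : M → ℝ} {p : M} {c : ℝ}
    (h : ∀ X Y, hessian I g φ p X Y = c * g p X Y) :
    laplacian I g φ p = c * Module.finrank ℝ E := by
  refine metricTrace_eq (hg.isInvertible_localMetric (mem_extChartAt_target p)) fun X Y => ?_
  rw [localMetric_self]
  exact h X Y

theorem IsSemiRiemannian.scalarCurvature_eq (hg : IsSemiRiemannian I g) {p : M} {c : ℝ}
    (h : ∀ X Y, ricci I g p X Y = c * g p X Y) :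
    scalarCurvature I g p = c * Module.finrank ℝ E := by
  refine metricTrace_eq (hg.isInvertible_localMetric (mem_extChartAt_target p)) fun X Y => ?_
  rw [localMetric_self]
  exact h X Y

/-- `H^{c ln φ} = c H^φ/φ - c dφ⊗dφ/φ²`, and with `a = -1/c` the quadratic term of Catino's equation
cancels the last summand. The case `c = 0` is covered, since then `1 / c = 0` and the potential
vanishes. -/
theorem isGeneralizedQuasiEinstein_const_mul_log {φ r l k : M → ℝ}
    (hφ : ContMDiff I 𝓘(ℝ, ℝ) ∞ φ) (h0 : ∀ p, φ p ≠ 0) (hk : ContMDiff I 𝓘(ℝ, ℝ) ∞ k)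
    (hric : ∀ (p : M) (X Y : TangentSpace I p), ricci I g p X Y = r p * g p X Y)
    (hhess : ∀ (p : M) (X Y : TangentSpace I p), hessian I g φ p X Y = l p * g p X Y)
    {c : ℝ} (hkeq : ∀ p, k p = r p + c * (l p / φ p)) :
    IsGeneralizedQuasiEinstein I g (fun p => c * Real.log (φ p)) (fun _ => -(1 / c)) k := by
  have hψ : ContMDiff I 𝓘(ℝ, ℝ) ∞ (fun p => c * Real.log (φ p)) := fun p =>
    ((contDiffAt_const.mul (Real.contDiffAt_log.2 (h0 p))).contMDiffAt.comp p (hφ p) :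
      ContMDiffAt I 𝓘(ℝ, ℝ) ∞ ((fun t => c * Real.log t) ∘ φ) p)
  refine ⟨hψ, contMDiff_const, hk, fun p X Y => ?_⟩
  have hφ' : ContDiffAt ℝ ∞ (φ ∘ (extChartAt I p).symm) (extChartAt I p p) :=
    contDiffAt_comp_extChartAt_symm hφ (mem_extChartAt_target p)
  have hval : (φ ∘ (extChartAt I p).symm) (extChartAt I p p) = φ p := by simp
  have h0' : (φ ∘ (extChartAt I p).symm) (extChartAt I p p) ≠ 0 := by rw [hval]; exact h0 p
  have hd : ∀ Z, differential I (fun p => c * Real.log (φ p)) p Z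
      = c * (differential I φ p Z / φ p) := fun Z => by
    rw [differential_eq_fderiv hψ, differential_eq_fderiv hφ]
    have e := (((hφ'.differentiableAt (by simp)).hasFDerivAt.log h0').const_mul c).fderiv
    refine (congrArg (fun L => L Z) e).trans ?_
    simp only [hval]
    rw [div_eq_inv_mul]
    rfl
  have hH : hessian I g (fun p => c * Real.log (φ p)) p X Y
      = c * (hessian I g φ p X Y / φ p - differential I φ p X * differential I φ p Y / φ p ^ 2) := by
    have e := hessianLocal_const_mul_log (localMetric I g p) hφ' h0' c X Y
    rw [hval, ← differential_eq_fderiv hφ] at e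
    exact e
  rw [hH, hd, hd, hric, hhess, hkeq]
  have := h0 p
  field_simp
  ring

end LogPotential

end SeqWarped

/-! ### The theorem -/

theorem theorem3p2
    {E₁ : Type*} [NormedAddCommGroup E₁] [NormedSpace ℝ E₁] [FiniteDimensional ℝ E₁]
    {H₁ : Type*} [TopologicalSpace H₁] (I₁ : ModelWithCorners ℝ E₁ H₁) [I₁.Boundaryless]
    {M₁ : Type*} [TopologicalSpace M₁] [ChartedSpace H₁ M₁] [IsManifold I₁ ∞ M₁]
    [ConnectedSpace M₁]
    {E₂ : Type*} [NormedAddCommGroup E₂] [NormedSpace ℝ E₂] [FiniteDimensional ℝ E₂]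
    {H₂ : Type*} [TopologicalSpace H₂] (I₂ : ModelWithCorners ℝ E₂ H₂) [I₂.Boundaryless]
    {M₂ : Type*} [TopologicalSpace M₂] [ChartedSpace H₂ M₂] [IsManifold I₂ ∞ M₂]
    [ConnectedSpace M₂]
    {E₃ : Type*} [NormedAddCommGroup E₃] [NormedSpace ℝ E₃] [FiniteDimensional ℝ E₃]
    {H₃ : Type*} [TopologicalSpace H₃] (I₃ : ModelWithCorners ℝ E₃ H₃) [I₃.Boundaryless]
    {M₃ : Type*} [TopologicalSpace M₃] [ChartedSpace H₃ M₃] [IsManifold I₃ ∞ M₃]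
    [ConnectedSpace M₃]
    (hm₁ : 0 < Module.finrank ℝ E₁) (hm₂ : 0 < Module.finrank ℝ E₂)
    (hm₃ : 0 < Module.finrank ℝ E₃)
    (g₁ : ∀ p : M₁, TangentSpace I₁ p →L[ℝ] TangentSpace I₁ p →L[ℝ] ℝ)
    (g₂ : ∀ p : M₂, TangentSpace I₂ p →L[ℝ] TangentSpace I₂ p →L[ℝ] ℝ)
    (g₃ : ∀ p : M₃, TangentSpace I₃ p →L[ℝ] TangentSpace I₃ p →L[ℝ] ℝ)
    (hg₁ : IsSemiRiemannian I₁ g₁) (hg₂ : IsSemiRiemannian I₂ g₂) (hg₃ : IsSemiRiemannian I₃ g₃)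
    (f : M₁ → ℝ) (hf : ContMDiff I₁ 𝓘(ℝ, ℝ) ∞ f) (hf_pos : ∀ x, 0 < f x)
    (h : M₁ × M₂ → ℝ) (hh : ContMDiff (I₁.prod I₂) 𝓘(ℝ, ℝ) ∞ h) (hh_pos : ∀ q, 0 < h q)
    (α β : ℝ) (hα : α ≠ 0) (hβ : β ≠ 0)
    (hflat : IsPseudoProjectivelyFlat ((I₁.prod I₂).prod I₃)
      (sequentialMetric I₁ I₂ I₃ g₁ g₂ g₃ f h) α β) :
    -- `(M₁, g₁, -ln f, λ₁/α)` is generalized quasi-Einstein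
    (∀ (y : M₂) (z : M₃), IsGeneralizedQuasiEinstein I₁ g₁
      (fun x => -Real.log (f x)) (fun _ => 1)
      (fun x => lambda₁ I₁ I₂ I₃ g₁ g₂ g₃ f h α β x y z / α)) ∧
    -- `(M₂, g₂, μ ln h, λ₂/(α-β))` is generalized quasi-Einstein, `μ = β m₃/(α-β)`
    (α ≠ β → ∀ (x : M₁) (z : M₃) (μ : ℝ), μ * (α - β) = β * Module.finrank ℝ E₃ →
      IsGeneralizedQuasiEinstein I₂ g₂
        (fun y => μ * Real.log (h (x, y))) (fun _ => -(1 / μ))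
        (fun y => lambda₂ I₁ I₂ I₃ g₁ g₂ g₃ f h α β x y z / (α - β))) ∧
    -- the same with `μ = β m₃ f²/(α-β)` and some factor
    (α ≠ β → ∀ (x : M₁) (μ : ℝ), μ * (α - β) = β * Module.finrank ℝ E₃ * f x ^ 2 →
      ∃ l : M₂ → ℝ, IsGeneralizedQuasiEinstein I₂ g₂
        (fun y => μ * Real.log (h (x, y))) (fun _ => -(1 / μ)) l) ∧
    -- conformal gradient soliton with potential `h` if `α = β`
    (α = β → ∀ x : M₁,
      (∀ z : M₃, SatisfiesConformalGradientEq I₂ g₂ (fun y => h (x, y))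
        (fun y => h (x, y) * lambda₂ I₁ I₂ I₃ g₁ g₂ g₃ f h α β x y z
          / (β * Module.finrank ℝ E₃))) ∧
      ((¬ ∃ c : ℝ, ∀ y : M₂, h (x, y) = c) →
        IsConformalGradientSoliton I₂ g₂ (fun y => h (x, y)))) ∧
    -- `(M₃, g₃)` is Einstein
    (α ≠ β → IsEinstein I₃ g₃) ∧
    -- `(1/f) H₁^f = (1/h) H₁^h` on `M₁`
    (∀ (x : M₁) (y : M₂) (X Y : TangentSpace I₁ x),
      1 / f x * hessian I₁ g₁ f x X Y
        = 1 / h (x, y) * hessian I₁ g₁ (fun x' => h (x', y)) x X Y) := by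
  have := Module.nontrivial_of_finrank_pos hm₁
  have := Module.nontrivial_of_finrank_pos hm₂
  have := Module.nontrivial_of_finrank_pos hm₃
  have hf0 : ∀ x, f x ≠ 0 := fun x => (hf_pos x).ne'
  have hh0 : ∀ q, h q ≠ 0 := fun q => (hh_pos q).ne'
  have hm₁' : (Module.finrank ℝ E₁ : ℝ) ≠ 0 := by exact_mod_cast hm₁.ne'
  have hm₃' : (Module.finrank ℝ E₃ : ℝ) ≠ 0 := by exact_mod_cast hm₃.ne'
  obtain ⟨κ, hκ⟩ : ∃ κ : M₁ → ℝ, ∀ x y z,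
      scalarFactor I₁ I₂ I₃ g₁ g₂ g₃ f h α β ((x, y), z)
        = κ x * (α + (Module.finrank ℝ E₁ + Module.finrank ℝ E₂ + Module.finrank ℝ E₃ - 1) * β) ∧
      SpaceFormEquations I₁ I₂ I₃ g₁ g₂ g₃ f h (κ x) (sqNormGradient I₁ I₂ g₁ g₂ f h x y)
        x y z := by
    -- The trace of `H₁^f = -κ f g₁` is `Δ₁f = -κ m₁ f`, so `κ` is determined by `x` alone.
    refine ⟨fun x => -(laplacian I₁ g₁ f x / (f x * Module.finrank ℝ E₁)), fun x y z => ?_⟩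
    obtain ⟨κ, h₁, h₂⟩ := exists_spaceFormEquations hg₁ hg₂ hg₃ hf hf0 hh hh0 hα hflat x y z
    have : κ = -(laplacian I₁ g₁ f x / (f x * Module.finrank ℝ E₁)) := by
      rw [hg₁.laplacian_eq h₂.hessian_f]
      have := hf0 x
      field_simp
    subst this
    exact ⟨h₁, h₂⟩
  obtain ⟨x₀⟩ := (inferInstance : Nonempty M₁)
  obtain ⟨y₀⟩ := (inferInstance : Nonempty M₂)
  obtain ⟨z₀⟩ := (inferInstance : Nonempty M₃)
  have hκ_smooth : ContMDiff I₁ 𝓘(ℝ, ℝ) ∞ κ := by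
    have hl : ContMDiff I₁ 𝓘(ℝ, ℝ) ∞ (fun x => -(κ x * f x)) :=
      hg₁.contMDiff_of_hessian_eq hf fun x => (hκ x y₀ z₀).2.hessian_f
    have e : κ = fun x => -(-(κ x * f x) / f x) := by
      funext x
      have := hf0 x
      field_simp
    rw [e]
    exact (hl.div₀ hf hf0).neg
  have hh₂ : ∀ x, ContMDiff I₂ 𝓘(ℝ, ℝ) ∞ (fun y => h (x, y)) := fun x =>
    hh.comp (contMDiff_const.prodMk contMDiff_id)
  let l : M₁ → M₂ → ℝ := fun x y => -(κ x * h (x, y) * f x ^ 2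
    + f x * gradInner I₁ g₁ (fun x' => h (x', y)) f x)
  have hl : ∀ x y (X Y : TangentSpace I₂ y),
      hessian I₂ g₂ (fun y' => h (x, y')) y X Y = l x y * g₂ y X Y := fun x y =>
    (hκ x y z₀).2.hessian_h₂
  have hl_smooth : ∀ x, ContMDiff I₂ 𝓘(ℝ, ℝ) ∞ (l x) := fun x =>
    hg₂.contMDiff_of_hessian_eq (hh₂ x) (hl x)
  -- The `β` terms add up to `β m₁ κ ((n-1) - (m₁-1) - m₂ - m₃) = 0`.
  have hlam₁ : ∀ x y z, lambda₁ I₁ I₂ I₃ g₁ g₂ g₃ f h α β x y z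
      = α * (Module.finrank ℝ E₁ * κ x) := fun x y z => by
    obtain ⟨hs, hE⟩ := hκ x y z
    have := hf0 x
    have := hh0 (x, y)
    rw [lambda₁, hs, hg₁.scalarCurvature_eq hE.ricci₁, hg₁.laplacian_eq hE.hessian_f,
      hg₁.laplacian_eq hE.hessian_h₁]
    field_simp
    ring
  have hlam₂ : ∀ x y z, lambda₂ I₁ I₂ I₃ g₁ g₂ g₃ f h α β x y z
      = (α - β) * ((Module.finrank ℝ E₂ - 1) * (κ x * f x ^ 2 + gradInner I₁ g₁ f f x))
        + β * Module.finrank ℝ E₃ * (l x y / h (x, y)) := fun x y z => by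
    obtain ⟨hs, hE⟩ := hκ x y z
    have := hf0 x
    have := hh0 (x, y)
    simp only [lambda₂, fSharp, hs, hg₂.scalarCurvature_eq hE.ricci₂,
      hg₁.laplacian_eq hE.hessian_f, hg₂.laplacian_eq hE.hessian_h₂, l]
    field_simp
    ring
  -- For fixed `x`, Ricci tensor and Hessian are separately multiples of `g₂`, so every constant `μ`
  -- works; this serves both choices of `μ`. The value `β m₃/(α-β)` matters only for identifying the
  -- factor with `λ₂/(α-β)`.
  have hquasi : ∀ x (μ : ℝ), IsGeneralizedQuasiEinstein I₂ g₂
      (fun y => μ * Real.log (h (x, y))) (fun _ => -(1 / μ))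
      (fun y => (Module.finrank ℝ E₂ - 1) * (κ x * f x ^ 2 + gradInner I₁ g₁ f f x)
        + μ * (l x y / h (x, y))) := fun x μ =>
    isGeneralizedQuasiEinstein_const_mul_log (hh₂ x) (fun y => hh0 _)
      (contMDiff_const.add (contMDiff_const.mul ((hl_smooth x).div₀ (hh₂ x) fun y => hh0 _)))
      (fun y => (hκ x y z₀).2.ricci₂) (hl x) fun y => rfl
  have hsoliton : α = β → ∀ x z, SatisfiesConformalGradientEq I₂ g₂ (fun y => h (x, y))
      (fun y => h (x, y) * lambda₂ I₁ I₂ I₃ g₁ g₂ g₃ f h α β x y z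
        / (β * Module.finrank ℝ E₃)) := fun hαβ x z => by
    have e : (fun y => h (x, y) * lambda₂ I₁ I₂ I₃ g₁ g₂ g₃ f h α β x y z
        / (β * Module.finrank ℝ E₃)) = l x := by
      funext y
      have := hh0 (x, y)
      -- For `α = β` the Ricci part of `λ₂` drops out, leaving `λ₂ = β m₃ l/h`.
      rw [hlam₂, hαβ]
      field_simp
      ring
    rw [e]
    exact ⟨hh₂ x, hl_smooth x, hl x⟩
  refine ⟨fun y z => ?_, fun hαβ x z μ hμ => ?_, fun _ x μ _ => ?_, fun hαβ x =>
    ⟨hsoliton hαβ x, fun hne => ⟨hne, _, hsoliton hαβ x z₀⟩⟩, fun _ => ?_, fun x y X Y => ?_⟩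
  -- The constant `c = -1` gives the potential `-ln f` and `a = 1`; the factor is `(m₁-1)κ + κ = m₁
  -- κ = λ₁/α`.
  · have hq := isGeneralizedQuasiEinstein_const_mul_log (I := I₁) (g := g₁) (c := -1)
      (k := fun x => lambda₁ I₁ I₂ I₃ g₁ g₂ g₃ f h α β x y z / α) hf hf0 ?_
      (fun x => (hκ x y z).2.ricci₁) (fun x => (hκ x y z).2.hessian_f) ?_
    · simpa using hq
    · have e : (fun x => lambda₁ I₁ I₂ I₃ g₁ g₂ g₃ f h α β x y z / α)
          = fun x => Module.finrank ℝ E₁ * κ x := by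
        funext x
        rw [hlam₁]
        field_simp
      rw [e]
      exact contMDiff_const.mul hκ_smooth
    · intro x
      have := hf0 x
      rw [hlam₁]
      field_simp
      ring
  · have hsub : α - β ≠ 0 := sub_ne_zero.2 hαβ
    have e : (fun y => lambda₂ I₁ I₂ I₃ g₁ g₂ g₃ f h α β x y z / (α - β)) = fun y =>
        (Module.finrank ℝ E₂ - 1) * (κ x * f x ^ 2 + gradInner I₁ g₁ f f x)
          + μ * (l x y / h (x, y)) := by
      funext y
      rw [hlam₂, ← hμ, div_eq_iff hsub]
      ring
    rw [e]
    exact hquasi x μ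
  · exact ⟨_, hquasi x μ⟩
  -- With `(x₀, y₀)` fixed, `κ`, `h` and the squared gradient norm do not involve `z`, so the factor
  -- is a constant on `M₃`.
  · exact ⟨_, fun z => (hκ x₀ y₀ z).2.ricci₃⟩
  · have := hf0 x
    have := hh0 (x, y)
    -- Both sides equal `-κ g₁(X,Y)`.
    rw [(hκ x y z₀).2.hessian_f, (hκ x y z₀).2.hessian_h₁]
    field_simp
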